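/- For $a,b>0$ and $g\in L^2(\mathbb{R})$, consider the Gabor system $\mathcal{G}(g,a\mathbb{Z}\times b\mathbb{Z})=\{M_{\omega}T_{x}g : (x,\omega)\in a\mathbb{Z}\times b\mathbb{Z}\}$, where $M_\omega T_x g(t)=g(t-x)e^{2\pi i\omega t}$. Its sharp lower and upper frame bounds $A(a,b)$ and $B(a,b)$ are the largest $A$ and the smallest $B$ in $[0,\infty]$ such that $$A\,\|f\|_2^2\le\sum_{(x,\omega)\in a\mathbb{Z}\times b\mathbb{Z}}|\langle f,M_\omega T_x g\rangle|^2\le B\,\|f\|_2^2\qquad\text{for all } f\in L^2(\mathbb{R}),$$ and the system is a frame if this holds for some real constants $0<A\le B<\infty$. **Theorem 2.1.** Let $g(t)=\sqrt{\pi/2}\,\operatorname{sech}(\pi t)$, let $n\ge 2$ be an integer, and let $a,b>0$ satisfy $(ab)^{-1}=n$. Then $\mathcal{G}(g,a\mathbb{Z}\times b\mathbb{Z})$ is a frame (so that $0<A(a,b)\le B(a,b)<\infty$), and $$A\left(\tfrac1{\sqrt n},\tfrac1{\sqrt n}\right)\ge A(a,b),\qquad B\left(\tfrac1{\sqrt n},\tfrac1{\sqrt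 n}\right)\le B(a,b),\qquad \frac{B\left(\tfrac1{\sqrt n},\tfrac1{\sqrt n}\right)}{A\left(\tfrac1{\sqrt n},\tfrac1{\sqrt n}\right)}\le\frac{B(a,b)}{A(a,b)},$$ where in each of the three inequalities equality holds if and only if $a=b=\tfrac1{\sqrt n}$. -/

import Mathlib

open MeasureTheory
open scoped ENNReal InnerProductSpace

noncomputable section

namespace GaborFrame

section Frames

variable {H : Type*} [NormedAddCommGroup H] [InnerProductSpace ℂ H] {ι : Type*}

/-- The middle term `∑ |⟨f, e i⟩|²` of the frame inequality, as an unconditional sum with values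
in `[0, ∞]` (the order of the two arguments of the inner product does not affect its modulus). -/
def frameSum (e : ι → H) (f : H) : ℝ≥0∞ :=
  ∑' i, ‖⟪e i, f⟫_ℂ‖ₑ ^ 2

/-- The sharp lower frame bound: the largest `A ∈ [0, ∞]` with
`A ‖f‖² ≤ ∑ |⟨f, e i⟩|²` for all `f`. -/
def lowerFrameBound (e : ι → H) : ℝ≥0∞ :=
  sSup {A : ℝ≥0∞ | ∀ f : H, A * ‖f‖ₑ ^ 2 ≤ frameSum e f}

/-- The sharp upper frame bound: the smallest `B ∈ [0, ∞]` with
`∑ |⟨f, e i⟩|² ≤ B ‖f‖²` for all `f`. -/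
def upperFrameBound (e : ι → H) : ℝ≥0∞ :=
  sInf {B : ℝ≥0∞ | ∀ f : H, frameSum e f ≤ B * ‖f‖ₑ ^ 2}

/-- A frame: the frame inequality holds with some constants `0 < A ≤ B < ∞`. -/
def IsFrame (e : ι → H) : Prop :=
  ∃ A B : ℝ, 0 < A ∧ A ≤ B ∧ ∀ f : H,
    ENNReal.ofReal A * ‖f‖ₑ ^ 2 ≤ frameSum e f ∧
      frameSum e f ≤ ENNReal.ofReal B * ‖f‖ₑ ^ 2

/-- The condition number `B / A`, the ratio of the sharp frame bounds. -/
def frameConditionNumber (e : ι → H) : ℝ≥0∞ :=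
  upperFrameBound e / lowerFrameBound e

end Frames

/-- The time-frequency shift `π(x, ω) g (t) = g (t - x) e^{2π i ω t}`. -/
def timeFreqShift (x ω : ℝ) (g : ℝ → ℂ) (t : ℝ) : ℂ :=
  g (t - x) * Complex.exp (2 * Real.pi * Complex.I * ω * t)

theorem memLp_timeFreqShift {g : ℝ → ℂ} (hg : MemLp g 2 volume) (x ω : ℝ) :
    MemLp (timeFreqShift x ω g) 2 volume := by
  have h1 : MemLp (fun t => g (t - x)) 2 volume :=
    hg.comp_measurePreserving (measurePreserving_sub_right volume x)
  have hc : Continuous fun t : ℝ => Complex.exp (2 * Real.pi * Complex.I * ω * t) := by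
    fun_prop
  refine h1.of_le (h1.aestronglyMeasurable.mul hc.aestronglyMeasurable) (.of_forall fun t => ?_)
  have h2 : (2 * Real.pi * Complex.I * ω * t : ℂ) = ((2 * Real.pi * ω * t : ℝ) : ℂ) * Complex.I := by
    push_cast
    ring
  simp only [timeFreqShift]
  rw [norm_mul, h2, Complex.norm_exp_ofReal_mul_I, mul_one]

/-- The Gabor system `{π(λ) g | λ ∈ aℤ × bℤ}` in `L²(ℝ)`, indexed by `(k, l) ∈ ℤ × ℤ` through
`λ = (a k, b l)`. -/
def gaborSystem (g : ℝ → ℂ) (hg : MemLp g 2 volume) (a b : ℝ) :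
    ℤ × ℤ → Lp ℂ 2 (volume : Measure ℝ) :=
  fun kl => (memLp_timeFreqShift hg (a * kl.1) (b * kl.2)).toLp _

/-- The hyperbolic secant window `g(t) = (π/2)^{1/2} sech(π t)`. -/
def sechWindow (t : ℝ) : ℂ :=
  ((Real.sqrt (Real.pi / 2) * (Real.cosh (Real.pi * t))⁻¹ : ℝ) : ℂ)

theorem memLp_sechWindow : MemLp sechWindow 2 volume := by
  have hc : Continuous sechWindow := by
    unfold sechWindow
    have h : Continuous fun t : ℝ => (Real.cosh (Real.pi * t))⁻¹ :=
      (Real.continuous_cosh.comp (continuous_const.mul continuous_id)).inv₀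
        fun t => (Real.cosh_pos _).ne'
    exact Complex.continuous_ofReal.comp (continuous_const.mul h)
  rw [memLp_two_iff_integrable_sq_norm hc.aestronglyMeasurable]
  refine (integrable_inv_one_add_sq.const_mul (Real.pi / 2)).mono'
    (hc.norm.pow 2).aestronglyMeasurable (.of_forall fun t => ?_)
  have h0 : (0 : ℝ) ≤ Real.pi / 2 := by positivity
  have h1 : t ^ 2 ≤ Real.sinh (Real.pi * t) ^ 2 := by
    rw [sq_le_sq, Real.abs_sinh, abs_mul, abs_of_pos Real.pi_pos]
    have h3 : |t| ≤ Real.pi * |t| :=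
      le_mul_of_one_le_left (abs_nonneg t) (by linarith [Real.pi_gt_three])
    exact h3.trans (Real.self_le_sinh_iff.2 (by positivity))
  have h2 : 1 + t ^ 2 ≤ Real.cosh (Real.pi * t) ^ 2 := by
    rw [Real.cosh_sq]
    linarith
  rw [Real.norm_of_nonneg (by positivity), sechWindow, Complex.norm_real, Real.norm_eq_abs,
    sq_abs, mul_pow, Real.sq_sqrt h0, inv_pow]
  exact mul_le_mul_of_nonneg_left (inv_anti₀ (by positivity) h2) h0

/-- The Gabor system `G(g, aℤ × bℤ)` of the hyperbolic secant window. -/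
def sechGabor (a b : ℝ) : ℤ × ℤ → Lp ℂ 2 (volume : Measure ℝ) :=
  gaborSystem sechWindow memLp_sechWindow a b

end GaborFrame

end

/-!
# Frame bounds of the hyperbolic secant at integer redundancy

Write `L = 1/b = na`. For `f` continuous with compact support, Parseval's identity for the
`L`-periodization of `f · g(· - ak)` turns the frame sum of `f` into an integral over `t` of
`∑ₖ |∑ⱼ zⱼ sech (πa (k + nj + nt))|²`, where `zⱼ = f (L (t + j))` (`frameSum_sechGabor`).
Expanding the square, everything rests on
`sech A · sech B = (tanh A - tanh B) / sinh (A - B)`: the sum over `k` telescopes, so its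
off-diagonal part is a Toeplitz form which does not depend on `t`, with the kernel
`m ↦ 2nm / sinh (πLm)`, while its diagonal part is the periodization
`G(c, y) = ∑ₖ sech² (c (k + y))` at `c = πa`, `y = nt` (`hasSum_sq_norm_sum_mul_sech`).

The Toeplitz form is bounded above by Schur's test. Below, it equals a sum of squares minus
`G(πL, 1/2)` times the identity, by the same expansion at `y = 1/2`. The Gamma reflection formula
computes the Fourier transform of `sech²`; Poisson summation then shows that `G(c, ·)` has its
maximum at `0` and its minimum at `1/2` (`sechSqSum_le`, `le_sechSqSum`). The two maxima are
approached simultaneously by trains of narrow bumps, and so are the two minima if the signs of the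
bumps alternate, since normalized finite sections of a Toeplitz kernel converge to its total mass
(`exists_almost_extremal`); the lower Toeplitz bound is attained by alternating signs because
`∑ⱼ (-1)ʲ sech (c (j + 1/2)) = 0` (`tsum_neg_one_zpow_mul_kap`). With
`S(s) = (πs/2) G(πs, 1/2)` and `H(s) = ∑ₖ πks / sinh (πks)` the sharp bounds are therefore
`n (S(a) - S(na))` and `n (H(1/a) + H(na) - 1)`. Since `S(s) + S(1/s) = 1` (`halfSum_inv`), it
remains to prove, for `αβ = n`, that `S(α) + S(β)` and `H(α) + H(β)` are minimal only at
`α = β = √n`.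

For this the derivatives `s S'(s)` and `s H'(s)` with respect to `log s` are compared at `n/α` and at
`α > √n` (`two_mul_lt_of_logScaleDeriv`). That of `H` is strictly increasing: for `s ≥ 1` this holds
term by term in the series defining `H`, and for `s ≤ 1` term by term in its Poisson dual. That of
`S` is invariant under `s ↦ 1/s`, so only `s ≥ 1` matters; there the comparison is again termwise,
except that the leading term is not monotone near `s = 1`, only from a point below `1.1` on. If the
smaller of the two points is below `1.1`, the other is at least `2 / 1.1`, because `n ≥ 2`,
and a numerical estimate of the leading term suffices (`sechRate_lt_of_near`, `two_mul_halfSum_lt`).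
-/

noncomputable section

namespace GaborFrame

open Real Filter Topology

/-! ### Correlations of the shifts of the hyperbolic secant -/

/-- The hyperbolic secant. -/
def sech (x : ℝ) : ℝ := (cosh x)⁻¹

theorem sech_pos (x : ℝ) : 0 < sech x := inv_pos.2 (cosh_pos x)

theorem sech_neg (x : ℝ) : sech (-x) = sech x := by simp [sech]

theorem sech_sq (x : ℝ) : sech x ^ 2 = 1 - tanh x ^ 2 := by
  have h := (cosh_pos x).ne'
  have h2 := cosh_sq x
  rw [sech, tanh_eq_sinh_div_cosh]
  field_simp
  linarith

theorem continuous_sech : Continuous sech :=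
  continuous_cosh.inv₀ fun x => (cosh_pos x).ne'

theorem sech_le_exp (x : ℝ) : sech x ≤ 2 * exp (-|x|) := by
  have h : exp |x| / 2 ≤ cosh x := by
    rw [← cosh_abs, cosh_eq]
    linarith [exp_pos (-|x|)]
  calc sech x ≤ (exp |x| / 2)⁻¹ := inv_anti₀ (by positivity) h
    _ = 2 * exp (-|x|) := by rw [exp_neg]; field_simp

theorem sech_le_one (x : ℝ) : sech x ≤ 1 := inv_le_one_of_one_le₀ (one_le_cosh x)

theorem sech_mul_sech {A B : ℝ} (h : A ≠ B) :
    sech A * sech B = (tanh A - tanh B) / sinh (A - B) := by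
  have h1 : sinh (A - B) ≠ 0 := by
    rw [Ne, sinh_eq_zero]
    exact sub_ne_zero.2 h
  rw [eq_div_iff h1, sinh_sub, sech, sech, tanh_eq_sinh_div_cosh, tanh_eq_sinh_div_cosh]
  have hA := (cosh_pos A).ne'
  have hB := (cosh_pos B).ne'
  field_simp

theorem summable_exp_neg_mul_abs_int {c : ℝ} (hc : 0 < c) :
    Summable fun k : ℤ => exp (-(c * |(k : ℝ)|)) := by
  have h : Summable fun k : ℕ => exp (-(c * (k : ℝ))) := by
    have := summable_exp_nat_mul_iff.2 (neg_lt_zero.2 hc)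
    refine this.congr fun k => ?_
    congr 1
    ring
  refine Summable.of_nat_of_neg ?_ ?_ <;> simpa using h

theorem summable_sech {c : ℝ} (hc : 0 < c) (y : ℝ) :
    Summable fun k : ℤ => sech (c * (k + y)) := by
  refine Summable.of_nonneg_of_le (fun k => (sech_pos _).le) (fun k => ?_)
    ((summable_exp_neg_mul_abs_int hc).mul_left (2 * exp (c * |y|)))
  refine (sech_le_exp _).trans ?_
  rw [mul_assoc, ← exp_add]
  gcongr
  rw [abs_mul, abs_of_pos hc]
  have : |(k : ℝ)| ≤ |k + y| + |y| := by
    calc |(k : ℝ)| = |(k + y) - y| := by ring_nf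
      _ ≤ _ := abs_sub _ _
  nlinarith

theorem summable_sech_sq {c : ℝ} (hc : 0 < c) (y : ℝ) :
    Summable fun k : ℤ => sech (c * (k + y)) ^ 2 :=
  Summable.of_nonneg_of_le (fun k => by positivity)
    (fun k => pow_le_of_le_one (sech_pos _).le (sech_le_one _) two_ne_zero) (summable_sech hc y)

theorem tendsto_tanh_atTop : Tendsto tanh atTop (𝓝 1) := by
  have h : Tendsto (fun x => 1 - exp (-x) * sech x) atTop (𝓝 (1 - 0)) := by
    refine tendsto_const_nhds.sub (squeeze_zero (fun x => mul_nonneg (exp_pos _).le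
      (sech_pos x).le) (fun x => mul_le_of_le_one_right (exp_pos _).le (sech_le_one x))
      (tendsto_exp_neg_atTop_nhds_zero))
  rw [sub_zero] at h
  refine h.congr fun x => ?_
  have := (cosh_pos x).ne'
  rw [sech, tanh_eq_sinh_div_cosh, ← cosh_sub_sinh]
  field_simp
  ring

theorem tendsto_tanh_atBot : Tendsto tanh atBot (𝓝 (-1)) := by
  have h := (tendsto_tanh_atTop.comp tendsto_neg_atBot_atTop).neg
  refine h.congr fun x => ?_
  simp [tanh_neg]

/-- A summable series over `ℤ` of consecutive differences telescopes. -/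
theorem hasSum_int_of_telescoping {u : ℤ → ℝ} {p q : ℝ}
    (hs : Summable fun k : ℤ => u (k + 1) - u k)
    (hp : Tendsto (fun n : ℕ => u (n : ℤ)) atTop (𝓝 p))
    (hq : Tendsto (fun n : ℕ => u (-(n : ℤ))) atTop (𝓝 q)) :
    HasSum (fun k : ℤ => u (k + 1) - u k) (p - q) := by
  have h3 : ∀ n : ℕ, ∑ i ∈ Finset.range n, (u ((i : ℤ) + 1) - u (i : ℤ)) = u (n : ℤ) - u 0 := by
    intro n
    induction n with
    | zero => simp
    | succ n ih => rw [Finset.sum_range_succ, ih, Nat.cast_succ]; ring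
  have h4 : ∀ n : ℕ, ∑ i ∈ Finset.range n,
      (u (-((i : ℤ) + 1) + 1) - u (-((i : ℤ) + 1))) = u 0 - u (-(n : ℤ)) := by
    intro n
    induction n with
    | zero => simp
    | succ n ih =>
      rw [Finset.sum_range_succ, ih, Nat.cast_succ, show -((n : ℤ) + 1) + 1 = -n by ring]
      ring
  have h1 : HasSum (fun n : ℕ => u ((n : ℤ) + 1) - u (n : ℤ)) (p - u 0) := by
    have hs1 : Summable fun n : ℕ => u ((n : ℤ) + 1) - u (n : ℤ) :=
      hs.comp_injective (i := fun n : ℕ => (n : ℤ)) Nat.cast_injective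
    refine hs1.hasSum_iff_tendsto_nat.2 ?_
    simp only [h3]
    exact hp.sub_const _
  have h2 : HasSum (fun n : ℕ => u (-((n : ℤ) + 1) + 1) - u (-((n : ℤ) + 1))) (u 0 - q) := by
    have hs2 : Summable fun n : ℕ => u (-((n : ℤ) + 1) + 1) - u (-((n : ℤ) + 1)) :=
      hs.comp_injective (i := fun n : ℕ => (-((n : ℤ) + 1) : ℤ)) fun m n h => by simpa using h
    refine hs2.hasSum_iff_tendsto_nat.2 ?_
    simp only [h4]
    exact hq.const_sub _
  have h := HasSum.of_nat_of_neg_add_one (f := fun k : ℤ => u (k + 1) - u k) h1 h2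
  rwa [sub_add_sub_cancel] at h

theorem summable_sech_mul_sech {c : ℝ} (hc : 0 < c) (y z : ℝ) :
    Summable fun k : ℤ => sech (c * (k + y)) * sech (c * (k + z)) :=
  Summable.of_nonneg_of_le (fun _ => mul_nonneg (sech_pos _).le (sech_pos _).le)
    (fun _ => mul_le_of_le_one_right (sech_pos _).le (sech_le_one _)) (summable_sech hc y)

theorem tendsto_tanh_natCast {c : ℝ} (hc : 0 < c) (y : ℝ) :
    Tendsto (fun n : ℕ => tanh (c * (n + y))) atTop (𝓝 1) :=
  tendsto_tanh_atTop.comp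
    ((tendsto_atTop_add_const_right _ _ tendsto_natCast_atTop_atTop).const_mul_atTop hc)

theorem tendsto_tanh_neg_natCast {c : ℝ} (hc : 0 < c) (y : ℝ) :
    Tendsto (fun n : ℕ => tanh (c * (-n + y))) atTop (𝓝 (-1)) :=
  tendsto_tanh_atBot.comp ((tendsto_atBot_add_const_right _ _
    (tendsto_neg_atTop_atBot.comp tendsto_natCast_atTop_atTop)).const_mul_atBot hc)

/-- The off-diagonal correlations of the shifts of `sech` along a coset of `ℤ` do not depend on
the coset, since the telescoping sum of `tanh` does not. -/
theorem hasSum_sech_mul_sech_nat {c : ℝ} (hc : 0 < c) (y : ℝ) {d : ℕ} (hd : d ≠ 0) :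
    HasSum (fun k : ℤ => sech (c * (k + d + y)) * sech (c * (k + y))) (2 * d / sinh (c * d)) := by
  have hcd : c * d ≠ 0 := mul_ne_zero hc.ne' (Nat.cast_ne_zero.2 hd)
  have hsinh : sinh (c * d) ≠ 0 := by rwa [Ne, sinh_eq_zero]
  -- `u (k + 1) - u k = tanh (c (k + d + y)) - tanh (c (k + y))`
  let u : ℤ → ℝ := fun k => ∑ i ∈ Finset.range d, tanh (c * (k + (i + y)))
  have hu : ∀ k : ℤ, u (k + 1) - u k
      = sech (c * (k + d + y)) * sech (c * (k + y)) * sinh (c * d) := by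
    intro k
    have h1 := Finset.sum_range_sub (fun i : ℕ => tanh (c * (k + (i + y)))) d
    rw [sech_mul_sech, show c * (k + d + y) - c * (k + y) = c * d by ring, div_mul_cancel₀ _ hsinh]
    · simp only [u, ← Finset.sum_sub_distrib]
      rw [show c * ((k : ℝ) + d + y) = c * (k + (d + y)) by ring]
      simp only [Nat.cast_zero, zero_add] at h1
      rw [← h1]
      refine Finset.sum_congr rfl fun i _ => ?_
      push_cast
      ring_nf
    · intro h
      apply hcd
      linarith
  have hs : Summable fun k => u (k + 1) - u k := by
    simp_rw [hu]
    refine Summable.mul_right _ ?_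
    refine (summable_sech_mul_sech hc (d + y) y).congr fun k => ?_
    rw [add_assoc]
  have hp : Tendsto (fun n : ℕ => u n) atTop (𝓝 (∑ i ∈ Finset.range d, 1)) := by
    refine tendsto_finsetSum _ fun i _ => ?_
    simpa using tendsto_tanh_natCast hc (i + y)
  have hq : Tendsto (fun n : ℕ => u (-n)) atTop (𝓝 (∑ i ∈ Finset.range d, (-1))) := by
    refine tendsto_finsetSum _ fun i _ => ?_
    simpa using tendsto_tanh_neg_natCast hc (i + y)
  have h := (hasSum_int_of_telescoping hs hp hq).div_const (sinh (c * d))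
  simp_rw [hu, mul_div_cancel_right₀ _ hsinh] at h
  rw [Finset.sum_const, Finset.sum_const, Finset.card_range, nsmul_eq_mul, nsmul_eq_mul,
    show (d : ℝ) * 1 - d * -1 = 2 * d by ring] at h
  exact h

/-- The off-diagonal correlation `2m / sinh (cm)`. At `m = 0` division by zero makes it `0`, so it
is purely off-diagonal. -/
def kap (c : ℝ) (m : ℤ) : ℝ := 2 * m / sinh (c * m)

@[simp] theorem kap_zero (c : ℝ) : kap c 0 = 0 := by simp [kap]

theorem kap_neg (c : ℝ) (m : ℤ) : kap c (-m) = kap c m := by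
  simp [kap, neg_div_neg_eq]

theorem kap_nonneg {c : ℝ} (hc : 0 < c) (m : ℤ) : 0 ≤ kap c m := by
  rcases le_total 0 m with h | h
  · have : (0 : ℝ) ≤ m := by exact_mod_cast h
    exact div_nonneg (by positivity) (sinh_nonneg_iff.2 (by positivity))
  · have : (m : ℝ) ≤ 0 := by exact_mod_cast h
    exact div_nonneg_of_nonpos (by linarith) (sinh_nonpos_iff.2 (by nlinarith))

theorem kap_mul (c : ℝ) (n : ℕ) (m : ℤ) : kap c (n * m) = n * kap (c * n) m := by
  simp only [kap]
  push_cast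
  rw [mul_assoc c]
  ring

/-- The periodization `∑ₖ sech² (c (k + y))`. -/
def sechSqSum (c y : ℝ) : ℝ := ∑' k : ℤ, sech (c * (k + y)) ^ 2

theorem sechSqSum_pos {c : ℝ} (hc : 0 < c) (y : ℝ) : 0 < sechSqSum c y :=
  (summable_sech_sq hc y).tsum_pos (fun k => by positivity) 0 (pow_pos (sech_pos _) 2)

/-- All correlations of the shifts of `sech` along a coset of `ℤ`: only the diagonal ones depend on
the coset. -/
theorem hasSum_sech_mul_sech {c : ℝ} (hc : 0 < c) (y : ℝ) (p q : ℤ) :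
    HasSum (fun k : ℤ => sech (c * (k + p + y)) * sech (c * (k + q + y)))
      ((if p = q then sechSqSum c y else 0) + kap c (p - q)) := by
  -- the case `q = 0`
  have key : ∀ d : ℤ, HasSum (fun k : ℤ => sech (c * (k + d + y)) * sech (c * (k + y)))
      ((if d = 0 then sechSqSum c y else 0) + kap c d) := by
    intro d
    rcases Int.lt_trichotomy d 0 with h | h | h
    · obtain ⟨n, rfl⟩ : ∃ n : ℕ, d = -n := ⟨d.natAbs, by omega⟩
      have hn : n ≠ 0 := by rintro rfl; simp at h
      have h1 := (Equiv.addRight (-(n : ℤ))).hasSum_iff.2 (hasSum_sech_mul_sech_nat hc y hn)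
      rw [if_neg (by omega), zero_add, kap_neg]
      convert h1 using 1
      · funext k
        simp only [Function.comp, Equiv.coe_addRight]
        push_cast
        ring_nf
      · simp [kap]
    · subst h
      simpa [sq, sechSqSum] using (summable_sech_sq hc y).hasSum
    · obtain ⟨n, rfl⟩ : ∃ n : ℕ, d = n := ⟨d.natAbs, by omega⟩
      have hn : n ≠ 0 := by rintro rfl; simp at h
      rw [if_neg (by omega), zero_add]
      simpa [kap] using hasSum_sech_mul_sech_nat hc y hn
  have h := (Equiv.addRight q).hasSum_iff.2 (key (p - q))
  simp only [sub_eq_zero] at h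
  convert h using 1
  funext k
  simp only [Function.comp, Equiv.coe_addRight]
  push_cast
  ring_nf

/-- The shear `(d, k) ↦ (k + d, k)`, which turns rows of `ℤ × ℤ` into diagonals. -/
def intShear : ℤ × ℤ ≃ ℤ × ℤ :=
  ⟨fun p => (p.2 + p.1, p.2), fun p => (p.1 - p.2, p.2), fun p => by simp, fun p => by simp⟩

theorem summable_kap {c : ℝ} (hc : 0 < c) : Summable (kap c) := by
  -- `kap c m ≤ ∑ₖ sech (c (k + m)) sech (c k)`, an iterated sum of a summable double series
  have h1 : Summable fun p : ℤ × ℤ => sech (c * (p.1 + 0)) * sech (c * (p.2 + 0)) :=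
    (summable_sech hc 0).mul_of_nonneg (summable_sech hc 0) (fun _ => (sech_pos _).le)
      fun _ => (sech_pos _).le
  have h2 := (intShear.summable_iff.2 h1).prod
  refine Summable.of_nonneg_of_le (kap_nonneg hc) (fun d => ?_) h2
  have h3 := (hasSum_sech_mul_sech hc 0 d 0).tsum_eq
  have h4 : ∑' k : ℤ,
      ((fun p : ℤ × ℤ => sech (c * (p.1 + 0)) * sech (c * (p.2 + 0))) ∘ intShear) (d, k) =
        (if d = 0 then sechSqSum c 0 else 0) + kap c (d - 0) := by
    rw [← h3]
    refine tsum_congr fun k => ?_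
    simp [intShear]
  rw [h4, sub_zero]
  have : 0 ≤ if d = 0 then sechSqSum c 0 else 0 := by
    split_ifs
    · exact (sechSqSum_pos hc 0).le
    · exact le_rfl
  linarith

/-! ### Fibres of the frame operator: Toeplitz forms -/

/-- The Toeplitz form with the off-diagonal kernel `kap c (i - j)`. -/
def kapForm (c : ℝ) (J : Finset ℤ) (z : ℤ → ℂ) : ℝ :=
  ∑ i ∈ J, ∑ j ∈ J, (z i * starRingEnd ℂ (z j)).re * kap c (i - j)

theorem sq_norm_sum_mul_ofReal (J : Finset ℤ) (z : ℤ → ℂ) (s : ℤ → ℝ) :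
    ‖∑ j ∈ J, z j * (s j : ℂ)‖ ^ 2
      = ∑ i ∈ J, ∑ j ∈ J, (z i * starRingEnd ℂ (z j)).re * (s i * s j) := by
  have h : ((‖∑ j ∈ J, z j * (s j : ℂ)‖ ^ 2 : ℝ) : ℂ)
      = ∑ i ∈ J, ∑ j ∈ J, (z i * starRingEnd ℂ (z j)) * ((s i * s j : ℝ) : ℂ) := by
    rw [Complex.ofReal_pow, ← Complex.mul_conj', map_sum, Finset.sum_mul_sum]
    refine Finset.sum_congr rfl fun i _ => Finset.sum_congr rfl fun j _ => ?_
    rw [map_mul, Complex.conj_ofReal]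
    push_cast
    ring
  have h2 := congrArg Complex.re h
  rw [Complex.ofReal_re, Complex.re_sum] at h2
  rw [h2]
  refine Finset.sum_congr rfl fun i _ => ?_
  rw [Complex.re_sum]
  refine Finset.sum_congr rfl fun j _ => ?_
  rw [Complex.re_mul_ofReal]

/-- The fibre of the frame operator over a coset: a multiple of the identity, which depends on
the coset, plus a Toeplitz form, which does not. -/
theorem hasSum_sq_norm_sum_mul_sech {c : ℝ} (hc : 0 < c) (y : ℝ) {n : ℕ} (hn : n ≠ 0)
    (J : Finset ℤ) (z : ℤ → ℂ) :
    HasSum (fun k : ℤ => ‖∑ j ∈ J, z j * (sech (c * (k + n * j + y)) : ℂ)‖ ^ 2)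
      (sechSqSum c y * ∑ j ∈ J, ‖z j‖ ^ 2 + n * kapForm (c * n) J z) := by
  simp only [sq_norm_sum_mul_ofReal]
  have h : HasSum (fun k : ℤ => ∑ i ∈ J, ∑ j ∈ J, (z i * starRingEnd ℂ (z j)).re
        * (sech (c * (k + n * i + y)) * sech (c * (k + n * j + y))))
      (∑ i ∈ J, ∑ j ∈ J, (z i * starRingEnd ℂ (z j)).re *
        ((if i = j then sechSqSum c y else 0) + n * kap (c * n) (i - j))) := by
    refine hasSum_sum fun i _ => hasSum_sum fun j _ => HasSum.mul_left _ ?_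
    have h1 := hasSum_sech_mul_sech hc y (n * i) (n * j)
    rw [← mul_sub, kap_mul] at h1
    have hn' : (n : ℤ) ≠ 0 := Nat.cast_ne_zero.2 hn
    simp only [mul_right_inj' hn'] at h1
    simpa only [Int.cast_mul, Int.cast_natCast] using h1
  convert h using 1
  simp only [mul_add, Finset.sum_add_distrib, kapForm, Finset.mul_sum, mul_ite, mul_zero,
    Finset.sum_ite_eq]
  congr 1
  · refine Finset.sum_congr rfl fun i hi => ?_
    rw [if_pos hi, Complex.mul_conj', ← Complex.ofReal_pow, Complex.ofReal_re, mul_comm]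
  · refine Finset.sum_congr rfl fun i _ => Finset.sum_congr rfl fun j _ => ?_
    ring

/-- Up to a multiple of the identity, the Toeplitz form is the sum of squares at the coset
`1/2 + ℤ`. -/
theorem neg_le_kapForm {c : ℝ} (hc : 0 < c) (J : Finset ℤ) (z : ℤ → ℂ) :
    -(sechSqSum c (1 / 2) * ∑ j ∈ J, ‖z j‖ ^ 2) ≤ kapForm c J z := by
  have h := (hasSum_sq_norm_sum_mul_sech hc (1 / 2) one_ne_zero J z).nonneg
    fun k => by positivity
  simp only [Nat.cast_one, one_mul, mul_one] at h
  linarith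

theorem sum_kap_sub_le {c : ℝ} (hc : 0 < c) (J : Finset ℤ) (i : ℤ) :
    ∑ j ∈ J, kap c (i - j) ≤ ∑' m, kap c m := by
  rw [← (Equiv.subLeft i).tsum_eq (kap c)]
  exact ((Equiv.subLeft i).summable_iff.2 (summable_kap hc)).sum_le_tsum J
    fun j _ => kap_nonneg hc _

/-- Schur's test. -/
theorem kapForm_le {c : ℝ} (hc : 0 < c) (J : Finset ℤ) (z : ℤ → ℂ) :
    kapForm c J z ≤ (∑' m, kap c m) * ∑ j ∈ J, ‖z j‖ ^ 2 := by
  have h1 : kapForm c J z ≤ ∑ i ∈ J, ∑ j ∈ J,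
      (‖z i‖ ^ 2 / 2 * kap c (i - j) + ‖z j‖ ^ 2 / 2 * kap c (j - i)) := by
    refine Finset.sum_le_sum fun i _ => Finset.sum_le_sum fun j _ => ?_
    rw [← neg_sub i j, kap_neg, ← add_mul]
    refine mul_le_mul_of_nonneg_right ?_ (kap_nonneg hc _)
    have h2 : (z i * starRingEnd ℂ (z j)).re ≤ ‖z i‖ * ‖z j‖ := by
      refine (Complex.re_le_norm _).trans ?_
      rw [norm_mul, RCLike.norm_conj]
    nlinarith [sq_nonneg (‖z i‖ - ‖z j‖)]
  have h3 : ∑ i ∈ J, ∑ j ∈ J,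
      (‖z i‖ ^ 2 / 2 * kap c (i - j) + ‖z j‖ ^ 2 / 2 * kap c (j - i))
      = ∑ i ∈ J, ‖z i‖ ^ 2 * ∑ j ∈ J, kap c (i - j) := by
    simp only [Finset.sum_add_distrib]
    rw [Finset.sum_comm (f := fun i j => ‖z j‖ ^ 2 / 2 * kap c (j - i)),
      ← Finset.sum_add_distrib]
    refine Finset.sum_congr rfl fun i _ => ?_
    rw [← Finset.sum_add_distrib, Finset.mul_sum]
    refine Finset.sum_congr rfl fun j _ => ?_
    ring
  rw [h3] at h1
  refine h1.trans ?_
  rw [Finset.mul_sum]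
  refine Finset.sum_le_sum fun i _ => ?_
  rw [mul_comm]
  exact mul_le_mul_of_nonneg_right (sum_kap_sub_le hc J i) (by positivity)

/-- The normalized finite sections of a summable Toeplitz kernel converge to its total mass. -/
theorem tendsto_toeplitz_mean {κ : ℤ → ℝ} (hκ : Summable κ) :
    Tendsto (fun N : ℕ => (∑ i ∈ Finset.Ico (0 : ℤ) N, ∑ j ∈ Finset.Ico (0 : ℤ) N, κ (i - j)) / N)
      atTop (𝓝 (∑' m, κ m)) := by
  -- `C N m` is the proportion of pairs in `[0, N)²` on the `m`-th diagonal
  let C : ℕ → ℤ → ℝ := fun N m =>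
    (((Finset.Ico (0 : ℤ) N).filter fun i => i - m ∈ Finset.Ico (0 : ℤ) N).card : ℝ) / N
  have hC : ∀ N m, C N m ∈ Set.Icc (0 : ℝ) 1 := by
    intro N m
    refine ⟨by positivity, div_le_one_of_le₀ ?_ (by positivity)⟩
    have := Finset.card_filter_le (Finset.Ico (0 : ℤ) N) fun i => i - m ∈ Finset.Ico (0 : ℤ) N
    rw [Int.card_Ico] at this
    have h2 : ((N : ℤ) - 0).toNat = N := by omega
    rw [h2] at this
    exact_mod_cast this
  have hlim : ∀ m : ℤ, Tendsto (fun N => C N m) atTop (𝓝 1) := by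
    intro m
    have h0 : Tendsto (fun N : ℕ => 1 - |(m : ℝ)| / N) atTop (𝓝 (1 - 0)) :=
      (tendsto_const_div_atTop_nhds_zero_nat _).const_sub _
    rw [sub_zero] at h0
    refine tendsto_of_tendsto_of_tendsto_of_le_of_le' h0 tendsto_const_nhds ?_
      (.of_forall fun N => (hC N m).2)
    filter_upwards [eventually_gt_atTop 0] with N hN
    have hN' : (0 : ℝ) < N := Nat.cast_pos.2 hN
    rw [← sub_nonneg]
    have h1 : Finset.Ico (max 0 m) (min (N : ℤ) (N + m)) ⊆
        (Finset.Ico (0 : ℤ) N).filter fun i => i - m ∈ Finset.Ico (0 : ℤ) N := by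
      intro i hi
      simp only [Finset.mem_filter, Finset.mem_Ico, max_le_iff, lt_min_iff] at hi ⊢
      omega
    have h2 := Finset.card_le_card h1
    rw [Int.card_Ico] at h2
    have h3 : (N : ℤ) - |m| ≤
        (((Finset.Ico (0 : ℤ) N).filter fun i => i - m ∈ Finset.Ico (0 : ℤ) N).card : ℤ) := by
      refine le_trans ?_ (Int.ofNat_le.2 h2)
      rcases abs_cases m with h | h <;> rw [h.1] <;> omega
    have h4 : (N : ℝ) - |(m : ℝ)| ≤
        (((Finset.Ico (0 : ℤ) N).filter fun i => i - m ∈ Finset.Ico (0 : ℤ) N).card : ℝ) := by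
      exact_mod_cast h3
    have h5 : C N m - (1 - |(m : ℝ)| / N) =
        ((((Finset.Ico (0 : ℤ) N).filter fun i => i - m ∈ Finset.Ico (0 : ℤ) N).card : ℝ)
          - (N - |(m : ℝ)|)) / N := by
      simp only [C]
      field_simp
    rw [h5]
    exact div_nonneg (by linarith) hN'.le
  have hsum : ∀ N : ℕ, (∑ i ∈ Finset.Ico (0 : ℤ) N, ∑ j ∈ Finset.Ico (0 : ℤ) N, κ (i - j)) / N
      = ∑' m, C N m * κ m := by
    intro N
    have h1 : ∀ i : ℤ, HasSum (fun m => if i - m ∈ Finset.Ico (0 : ℤ) N then κ m else 0)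
        (∑ j ∈ Finset.Ico (0 : ℤ) N, κ (i - j)) := by
      intro i
      rw [← (Equiv.subLeft i).hasSum_iff]
      have h2 : ((fun m => if i - m ∈ Finset.Ico (0 : ℤ) N then κ m else 0) ∘ Equiv.subLeft i)
          = fun j => if j ∈ Finset.Ico (0 : ℤ) N then κ (i - j) else 0 := by
        funext j
        simp [Equiv.subLeft_apply]
      rw [h2, ← Finset.sum_congr rfl fun j hj => if_pos (c := j ∈ Finset.Ico (0 : ℤ) N) hj]
      exact hasSum_sum_of_ne_finset_zero fun j hj => if_neg hj
    have h2 := (hasSum_sum (s := Finset.Ico (0 : ℤ) N) fun i _ => h1 i).div_const (N : ℝ)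
    rw [← h2.tsum_eq]
    refine tsum_congr fun m => ?_
    rw [← Finset.sum_filter, Finset.sum_const, nsmul_eq_mul]
    simp only [C]
    ring
  simp only [hsum]
  have := tendsto_tsum_of_dominated_convergence (f := fun N m => C N m * κ m)
    (g := fun m => 1 * κ m) (𝓕 := atTop) (bound := fun m => ‖κ m‖) hκ.norm
    (fun m => (hlim m).mul_const _)
    (.of_forall fun N m => by
      rw [norm_mul, Real.norm_of_nonneg (hC N m).1]
      exact mul_le_of_le_one_left (norm_nonneg _) (hC N m).2)
  simpa using this

theorem summable_zpow_mul_kap {c : ℝ} (hc : 0 < c) {ζ : ℂ} (hζ : ‖ζ‖ = 1) :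
    Summable fun d : ℤ => ζ ^ d * (kap c d : ℂ) := by
  refine Summable.of_norm_bounded (summable_kap hc) fun d => ?_
  rw [norm_mul, norm_zpow, hζ, one_zpow, one_mul, Complex.norm_real,
    Real.norm_of_nonneg (kap_nonneg hc _)]

/-- A product of two sums over `ℤ`, expanded along the diagonals. -/
theorem tsum_mul_tsum_eq_tsum_diagonals {a b : ℤ → ℂ} (ha : Summable fun j : ℤ => ‖a j‖)
    (hb : Summable fun j : ℤ => ‖b j‖) :
    (∑' j : ℤ, a j) * (∑' j : ℤ, b j) = ∑' d : ℤ, ∑' k : ℤ, a (k + d) * b k := by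
  have h := (intShear.summable_iff.2 (summable_mul_of_summable_norm ha hb)).tsum_prod
  rw [tsum_mul_tsum_of_summable_norm ha hb, ← intShear.tsum_eq]
  exact h

/-- The square of `∑ⱼ ζʲ sech (c (j + 1/2))`, expanded along the diagonals. -/
theorem sq_norm_tsum_zpow_mul_sech {c : ℝ} (hc : 0 < c) {ζ : ℂ} (hζ : ‖ζ‖ = 1) :
    ((‖∑' j : ℤ, ζ ^ j * (sech (c * (j + 1 / 2)) : ℂ)‖ ^ 2 : ℝ) : ℂ)
      = sechSqSum c (1 / 2) + ∑' d : ℤ, ζ ^ d * (kap c d : ℂ) := by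
  have hζ0 : ζ ≠ 0 := by rintro rfl; simp at hζ
  have hζn : ∀ j : ℤ, ‖ζ ^ j‖ = 1 := fun j => by rw [norm_zpow, hζ, one_zpow]
  have hs : Summable fun j : ℤ => ‖ζ ^ j * (sech (c * (j + 1 / 2)) : ℂ)‖ := by
    refine (summable_sech hc (1 / 2)).congr fun j => ?_
    rw [norm_mul, hζn, one_mul, Complex.norm_real, Real.norm_of_nonneg (sech_pos _).le]
  have hinner : ∀ d : ℤ, ∑' k : ℤ, ζ ^ (k + d) * (sech (c * ((k + d : ℤ) + 1 / 2)) : ℂ) *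
        starRingEnd ℂ (ζ ^ k * (sech (c * (k + 1 / 2)) : ℂ))
      = (if d = 0 then (sechSqSum c (1 / 2) : ℂ) else 0) + ζ ^ d * (kap c d : ℂ) := by
    intro d
    have hterm : ∀ k : ℤ, ζ ^ (k + d) * (sech (c * ((k + d : ℤ) + 1 / 2)) : ℂ) *
        starRingEnd ℂ (ζ ^ k * (sech (c * (k + 1 / 2)) : ℂ))
      = ζ ^ d * ((sech (c * (k + d + 1 / 2)) * sech (c * (k + (0 : ℤ) + 1 / 2)) : ℝ) : ℂ) := by
      intro k
      have h1 : ζ ^ k * starRingEnd ℂ (ζ ^ k) = 1 := by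
        rw [Complex.mul_conj', hζn, Complex.ofReal_one, one_pow]
      rw [map_mul, Complex.conj_ofReal, zpow_add₀ hζ0, Int.cast_zero, add_zero, Int.cast_add,
        Complex.ofReal_mul]
      linear_combination
        (ζ ^ d * (sech (c * (k + d + 1 / 2)) : ℂ) * (sech (c * (k + 1 / 2)) : ℂ)) * h1
    rw [tsum_congr hterm, tsum_mul_left, ← Complex.ofReal_tsum,
      (hasSum_sech_mul_sech hc (1 / 2) d 0).tsum_eq, sub_zero]
    split_ifs with h
    · subst h
      simp
    · simp
  rw [Complex.ofReal_pow, ← Complex.mul_conj', Complex.conj_tsum,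
    tsum_mul_tsum_eq_tsum_diagonals hs (by simpa only [RCLike.norm_conj] using hs),
    tsum_congr hinner,
    ((hasSum_ite_eq (0 : ℤ) (sechSqSum c (1 / 2) : ℂ)).summable).tsum_add
      (summable_zpow_mul_kap hc hζ), tsum_ite_eq]

/-- The alternating character attains the lower bound of `neg_le_kapForm`: for `ζ = -1` the sum
`∑ⱼ ζʲ sech (c (j + 1/2))` vanishes by the symmetry `j ↦ -1 - j`. -/
theorem tsum_neg_one_zpow_mul_kap {c : ℝ} (hc : 0 < c) :
    ∑' d : ℤ, (-1 : ℝ) ^ d * kap c d = -sechSqSum c (1 / 2) := by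
  have h := sq_norm_tsum_zpow_mul_sech hc (ζ := -1) (by simp)
  have h0 : ∑' j : ℤ, (-1 : ℂ) ^ j * (sech (c * (j + 1 / 2)) : ℂ) = 0 := by
    have h1 := (Equiv.subLeft (-1 : ℤ)).tsum_eq
      fun j : ℤ => (-1 : ℂ) ^ j * (sech (c * (j + 1 / 2)) : ℂ)
    have h2 : ∀ j : ℤ, (-1 : ℂ) ^ (Equiv.subLeft (-1 : ℤ) j) *
        (sech (c * ((Equiv.subLeft (-1 : ℤ) j : ℤ) + 1 / 2)) : ℂ)
        = -((-1 : ℂ) ^ j * (sech (c * (j + 1 / 2)) : ℂ)) := by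
      intro j
      rw [Equiv.subLeft_apply, zpow_sub₀ (by norm_num)]
      have h3 : c * (((-1 - j : ℤ) : ℝ) + 1 / 2) = -(c * (j + 1 / 2)) := by push_cast; ring
      rw [h3, sech_neg]
      rcases Int.even_or_odd j with hj | hj
      · simp [hj.neg_one_zpow]
      · simp [hj.neg_one_zpow]
    simp only [h2, tsum_neg] at h1
    exact self_eq_neg.1 h1.symm
  rw [h0] at h
  have h2 : ((∑' d : ℤ, (-1 : ℝ) ^ d * kap c d : ℝ) : ℂ) = ((-sechSqSum c (1 / 2) : ℝ) : ℂ) := by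
    push_cast
    simp only [norm_zero, ne_eq, OfNat.ofNat_ne_zero, not_false_eq_true, zero_pow,
      Complex.ofReal_zero] at h
    linear_combination -h
  exact_mod_cast h2

/-! ### Fourier transform and Poisson summation -/

theorem hasDerivAt_tanh (x : ℝ) : HasDerivAt tanh (sech x ^ 2) x := by
  have h := (hasDerivAt_sinh x).div (hasDerivAt_cosh x) (cosh_pos x).ne'
  have h2 : (fun x => tanh x) = sinh / cosh := by
    funext t
    rw [Pi.div_apply, tanh_eq_sinh_div_cosh]
  rw [show tanh = sinh / cosh from h2]
  refine h.congr_deriv ?_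
  have h3 := (cosh_pos x).ne'
  have h4 := cosh_sq x
  unfold sech
  field_simp
  linarith

/-- The Fourier integral of `sech²`, a Beta integral in the variable `u = (1 + tanh t) / 2`. -/
theorem integral_sech_sq_mul_exp (ξ : ℝ) :
    ∫ t : ℝ, (sech t ^ 2 / 2) • Complex.exp (2 * Complex.I * ξ * t)
      = Complex.Gamma (1 + Complex.I * ξ) * Complex.Gamma (1 - Complex.I * ξ) := by
  have hre : (0 : ℝ) < (1 + Complex.I * ξ).re ∧ (0 : ℝ) < (1 - Complex.I * ξ).re := by simp
  have hβ := Complex.betaIntegral_eq_Gamma_mul_div _ _ hre.1 hre.2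
  rw [show (1 + Complex.I * ξ + (1 - Complex.I * ξ) : ℂ) = ((1 : ℕ) : ℂ) + 1 by push_cast; ring,
    Complex.Gamma_nat_eq_factorial, Nat.factorial_one, Nat.cast_one, div_one] at hβ
  rw [← hβ, Complex.betaIntegral, intervalIntegral.integral_of_le zero_le_one,
    integral_Ioc_eq_integral_Ioo]
  have himg : (fun t : ℝ => (1 + tanh t) / 2) '' Set.univ = Set.Ioo 0 1 := by
    ext u
    constructor
    · rintro ⟨t, -, rfl⟩
      have := tanh_bijOn.mapsTo (Set.mem_univ t)
      constructor <;> linarith [this.1, this.2]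
    · rintro ⟨h0, h1⟩
      obtain ⟨t, -, ht⟩ := tanh_surjOn (show 2 * u - 1 ∈ Set.Ioo (-1 : ℝ) 1 from
        ⟨by linarith, by linarith⟩)
      exact ⟨t, trivial, by simp only [ht]; ring⟩
  rw [← himg, integral_image_eq_integral_abs_deriv_smul (f' := fun t => sech t ^ 2 / 2)
    MeasurableSet.univ
    (fun t _ => (((hasDerivAt_tanh t).const_add 1).div_const 2).hasDerivWithinAt)
    (fun s _ t _ h => tanh_injective (by simpa using h)), Measure.restrict_univ]
  refine integral_congr_ae (.of_forall fun t => ?_)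
  simp only
  rw [abs_of_nonneg (by positivity)]
  congr 1
  have hc := cosh_pos t
  have hu : (1 + tanh t) / 2 = exp t / (2 * cosh t) := by
    rw [tanh_eq_sinh_div_cosh, ← sinh_add_cosh]
    field_simp
    ring
  have hv : 1 - (1 + tanh t) / 2 = exp (-t) / (2 * cosh t) := by
    rw [tanh_eq_sinh_div_cosh, ← cosh_sub_sinh]
    field_simp
    ring
  have hv' : (1 : ℂ) - (((1 + tanh t) / 2 : ℝ) : ℂ) = ((exp (-t) / (2 * cosh t) : ℝ) : ℂ) := by
    rw [← hv]
    push_cast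
    ring
  rw [hv', hu, add_sub_cancel_left, show (1 - Complex.I * ξ - 1 : ℂ) = -(Complex.I * ξ) by ring]
  have p1 : 0 < exp t / (2 * cosh t) := by positivity
  have p2 : 0 < exp (-t) / (2 * cosh t) := by positivity
  rw [Complex.cpow_def_of_ne_zero (by exact_mod_cast p1.ne'),
    Complex.cpow_def_of_ne_zero (by exact_mod_cast p2.ne'), ← Complex.exp_add,
    ← Complex.ofReal_log p1.le, ← Complex.ofReal_log p2.le,
    Real.log_div (exp_pos _).ne' (by positivity), Real.log_div (exp_pos _).ne' (by positivity),
    Real.log_exp, Real.log_exp]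
  congr 1
  push_cast
  ring

theorem Gamma_mul_Gamma_one_sub_I {ξ : ℝ} (hξ : ξ ≠ 0) :
    Complex.Gamma (1 + Complex.I * ξ) * Complex.Gamma (1 - Complex.I * ξ)
      = ((π * ξ / sinh (π * ξ) : ℝ) : ℂ) := by
  have h0 : Complex.I * ξ ≠ 0 := mul_ne_zero Complex.I_ne_zero (Complex.ofReal_ne_zero.2 hξ)
  rw [add_comm (1 : ℂ), Complex.Gamma_add_one _ h0, mul_assoc, Complex.Gamma_mul_Gamma_one_sub,
    show (π * (Complex.I * ξ) : ℂ) = ((π * ξ : ℝ) : ℂ) * Complex.I by push_cast; ring,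
    Complex.sin_mul_I, ← Complex.ofReal_sinh]
  have h1 : ((sinh (π * ξ) : ℝ) : ℂ) ≠ 0 := by
    rw [Complex.ofReal_ne_zero, Ne, sinh_eq_zero]
    exact mul_ne_zero pi_ne_zero hξ
  push_cast at h1 ⊢
  field_simp [Complex.I_ne_zero]

open FourierTransform in
theorem fourier_sech_sq {s : ℝ} (hs : 0 < s) (d : ℤ) :
    𝓕 (fun t : ℝ => ((π / (2 * s) * sech (π / s * t) ^ 2 : ℝ) : ℂ)) d
      = (if d = 0 then 1 else 0) + (π * s / 2 : ℂ) * kap (π * s) d := by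
  rw [fourier_real_eq_integral_exp_smul]
  have hπs : 0 < π / s := div_pos pi_pos hs
  have h1 : ∀ t : ℝ, Complex.exp (((-2 * π * t * d : ℝ) : ℂ) * Complex.I) •
      ((π / (2 * s) * sech (π / s * t) ^ 2 : ℝ) : ℂ)
      = (fun τ : ℝ => (π / s) •
        ((sech τ ^ 2 / 2) • Complex.exp (2 * Complex.I * (-(s * d) : ℝ) * τ))) (π / s * t) := by
    intro t
    have h2 : (((-2 * π * t * d : ℝ) : ℂ) * Complex.I)
        = 2 * Complex.I * (-(s * d) : ℝ) * ((π / s * t : ℝ) : ℂ) := by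
      have : (s : ℂ) ≠ 0 := by exact_mod_cast hs.ne'
      push_cast
      field_simp
    simp only [h2, Complex.real_smul, smul_eq_mul]
    push_cast
    ring
  simp only [h1]
  rw [Measure.integral_comp_mul_left (fun τ : ℝ =>
      (π / s) • ((sech τ ^ 2 / 2) • Complex.exp (2 * Complex.I * (-(s * d) : ℝ) * τ))),
    integral_smul, smul_smul, abs_of_pos (inv_pos.2 hπs), inv_mul_cancel₀ hπs.ne', one_smul,
    integral_sech_sq_mul_exp]
  split_ifs with h
  · subst h
    simp
  · have hsd : -(s * (d : ℝ)) ≠ 0 :=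
      neg_ne_zero.2 (mul_ne_zero hs.ne' (Int.cast_ne_zero.2 h))
    rw [Gamma_mul_Gamma_one_sub_I hsd, zero_add, kap]
    norm_cast
    rw [mul_neg, sinh_neg, neg_div_neg_eq, mul_assoc π s]
    push_cast
    ring

theorem norm_exp_two_pi_mul_I_mul (x : ℝ) : ‖Complex.exp (2 * π * Complex.I * x)‖ = 1 := by
  rw [show (2 * π * Complex.I * x : ℂ) = ((2 * π * x : ℝ) : ℂ) * Complex.I by push_cast; ring]
  exact Complex.norm_exp_ofReal_mul_I _

/-- Poisson summation for `sech²`. -/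
theorem poisson_sech_sq {s : ℝ} (hs : 0 < s) (x : ℝ) :
    ((π / (2 * s) * sechSqSum (π / s) x : ℝ) : ℂ) =
      1 + (π * s / 2 : ℂ) *
        ∑' d : ℤ, Complex.exp (2 * π * Complex.I * x) ^ d * (kap (π * s) d : ℂ) := by
  have hπs : 0 < π / s := div_pos pi_pos hs
  have hζ := norm_exp_two_pi_mul_I_mul x
  have hsum := summable_zpow_mul_kap (mul_pos pi_pos hs) hζ
  have hcont : Continuous fun t : ℝ => ((π / (2 * s) * sech (π / s * t) ^ 2 : ℝ) : ℂ) :=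
    Complex.continuous_ofReal.comp (continuous_const.mul
      ((continuous_sech.comp (continuous_const.mul continuous_id)).pow 2))
  have hO : (fun t : ℝ => ((π / (2 * s) * sech (π / s * t) ^ 2 : ℝ) : ℂ))
      =O[cocompact ℝ] fun t : ℝ => |t| ^ (-2 : ℝ) := by
    refine Asymptotics.IsBigO.of_bound (π / (2 * s) * (s / π) ^ 2) ?_
    have : ∀ᶠ t : ℝ in cocompact ℝ, t ≠ 0 := by
      simpa using (isCompact_singleton (x := (0 : ℝ))).compl_mem_cocompact
    filter_upwards [this] with t ht
    have ht' := abs_pos.2 ht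
    rw [Complex.norm_real, Real.norm_of_nonneg (by positivity), Real.norm_of_nonneg (by positivity),
      mul_assoc]
    refine mul_le_mul_of_nonneg_left ?_ (by positivity)
    have h1 : (π / s * t) ^ 2 ≤ cosh (π / s * t) ^ 2 := by
      rw [cosh_sq, ← sq_abs (sinh _), abs_sinh, ← sq_abs]
      have := self_le_sinh_iff.2 (abs_nonneg (π / s * t))
      have := pow_le_pow_left₀ (abs_nonneg (π / s * t)) this 2
      linarith
    rw [sech, inv_pow, rpow_neg (abs_nonneg t)]
    have h2 : (s / π) ^ 2 * (|t| ^ (2 : ℝ))⁻¹ = ((π / s * t) ^ 2)⁻¹ := by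
      rw [rpow_two, sq_abs]
      field_simp
    rw [h2]
    exact inv_anti₀ (by positivity) h1
  have hF : ∀ d : ℤ, _ := fourier_sech_sq hs
  have hδ : Summable fun d : ℤ => if d = 0 then (1 : ℂ) else 0 :=
    (hasSum_ite_eq (0 : ℤ) (1 : ℂ)).summable
  have hk : Summable fun d : ℤ => (kap (π * s) d : ℂ) := by
    exact_mod_cast summable_kap (mul_pos pi_pos hs)
  have hP := Real.tsum_eq_tsum_fourier_of_rpow_decay_of_summable hcont one_lt_two hO
    (by simp only [hF]; exact hδ.add (hk.mul_left _)) x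
  have hL : ∑' n : ℤ, ((π / (2 * s) * sech (π / s * (x + n)) ^ 2 : ℝ) : ℂ)
      = ((π / (2 * s) * sechSqSum (π / s) x : ℝ) : ℂ) := by
    rw [← Complex.ofReal_tsum, tsum_mul_left, sechSqSum]
    simp only [add_comm]
  rw [← hL, hP]
  have hR : ∀ d : ℤ, ((if d = 0 then 1 else 0) + (π * s / 2 : ℂ) * kap (π * s) d) *
      fourier d (x : UnitAddCircle) = (if d = 0 then (1 : ℂ) else 0) + (π * s / 2 : ℂ) *
        (Complex.exp (2 * π * Complex.I * x) ^ d * (kap (π * s) d : ℂ)) := by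
    intro d
    have h3 : fourier d (x : UnitAddCircle) = Complex.exp (2 * π * Complex.I * x) ^ d := by
      rw [fourier_coe_apply, ← Complex.exp_int_mul]
      congr 1
      push_cast
      ring
    rw [h3]
    split_ifs with h
    · subst h; simp
    · ring
  simp only [hF, hR]
  rw [hδ.tsum_add (hsum.mul_left _), tsum_ite_eq, tsum_mul_left]

/-- `S(s) = (π s / 2) ∑ₖ sech² (π s (k + 1/2))`, the normalized minimum of the periodization. -/
def halfSum (s : ℝ) : ℝ := π * s / 2 * sechSqSum (π * s) (1 / 2)

/-- `H(s) = ∑ₖ π k s / sinh (π k s)`, the sum of the ambiguity function of the window over `sℤ` on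
a coordinate axis. The value `1` at `k = 0` is added by hand, because `kap` vanishes there. -/
def ambiguitySum (s : ℝ) : ℝ := 1 + π * s / 2 * ∑' d : ℤ, kap (π * s) d

/-- Poisson summation at `1/2` turns `S(1/s)` into an alternating sum of `kap`, which the expansion
at `ζ = -1` turns back into `S(s)`. -/
theorem halfSum_inv {s : ℝ} (hs : 0 < s) : halfSum s⁻¹ = 1 - halfSum s := by
  have h := poisson_sech_sq hs (1 / 2)
  have h1 : Complex.exp (2 * π * Complex.I * ((1 / 2 : ℝ) : ℂ)) = ((-1 : ℝ) : ℂ) := by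
    rw [show (2 * π * Complex.I * ((1 / 2 : ℝ) : ℂ)) = π * Complex.I by push_cast; ring,
      Complex.exp_pi_mul_I]
    simp
  rw [h1] at h
  have h2 : π / (2 * s) * sechSqSum (π / s) (1 / 2) = 1 + π * s / 2 *
      ∑' d : ℤ, (-1 : ℝ) ^ d * kap (π * s) d := by
    exact_mod_cast h
  rw [tsum_neg_one_zpow_mul_kap (mul_pos pi_pos hs)] at h2
  rw [halfSum, halfSum, ← div_eq_mul_inv, div_div, mul_comm s 2, h2]
  ring

/-- The Poisson dual of the series defining `H`. -/
theorem ambiguitySum_eq {s : ℝ} (hs : 0 < s) :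
    ambiguitySum s = π / (2 * s) * sechSqSum (π / s) 0 := by
  have h := poisson_sech_sq hs 0
  simp only [Complex.ofReal_zero, mul_zero, Complex.exp_zero, one_zpow, one_mul] at h
  rw [ambiguitySum]
  exact_mod_cast h.symm

theorem sechSqSum_le {c : ℝ} (hc : 0 < c) (x : ℝ) : sechSqSum c x ≤ sechSqSum c 0 := by
  obtain ⟨s, hs, rfl⟩ : ∃ s : ℝ, 0 < s ∧ c = π / s :=
    ⟨π / c, div_pos pi_pos hc, by field_simp⟩
  have h := congrArg (‖·‖) (poisson_sech_sq hs x)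
  have h0 := ambiguitySum_eq hs
  have hζ := norm_exp_two_pi_mul_I_mul x
  have hpos : 0 < π / (2 * s) := by positivity
  simp only [Complex.norm_real] at h
  rw [Real.norm_of_nonneg (mul_pos hpos (sechSqSum_pos hc x)).le] at h
  refine le_of_mul_le_mul_left ?_ hpos
  rw [h, ← h0, ambiguitySum]
  refine (norm_add_le _ _).trans ?_
  rw [norm_one, norm_mul]
  gcongr
  · rw [show (π * s / 2 : ℂ) = ((π * s / 2 : ℝ) : ℂ) by push_cast; ring, Complex.norm_real,
      Real.norm_of_nonneg (by positivity)]
  · refine tsum_of_norm_bounded (summable_kap (mul_pos pi_pos hs)).hasSum fun d => ?_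
    rw [norm_mul, norm_zpow, hζ, one_zpow, one_mul, Complex.norm_real,
      Real.norm_of_nonneg (kap_nonneg (mul_pos pi_pos hs) _)]

/-- The minimum of the periodization is at the half-integers: by Poisson summation it is dual to
the expansion of a square of modulus. -/
theorem le_sechSqSum {c : ℝ} (hc : 0 < c) (x : ℝ) : sechSqSum c (1 / 2) ≤ sechSqSum c x := by
  obtain ⟨s, hs, rfl⟩ : ∃ s : ℝ, 0 < s ∧ c = π / s :=
    ⟨π / c, div_pos pi_pos hc, by field_simp⟩
  have h := poisson_sech_sq hs x
  have h0 := halfSum_inv hs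
  have hζ := norm_exp_two_pi_mul_I_mul x
  have hpos : 0 < π / (2 * s) := by positivity
  have hsq := sq_norm_tsum_zpow_mul_sech (mul_pos pi_pos hs) hζ
  refine le_of_mul_le_mul_left ?_ hpos
  rw [halfSum, halfSum, ← div_eq_mul_inv, div_div, mul_comm s 2] at h0
  rw [h0]
  set N := ‖∑' j : ℤ, Complex.exp (2 * π * Complex.I * x) ^ j * (sech (π * s * (j + 1 / 2)) : ℂ)‖
  have h1 : ((π / (2 * s) * sechSqSum (π / s) x : ℝ) : ℂ)
      = ((1 + π * s / 2 * (N ^ 2 - sechSqSum (π * s) (1 / 2)) : ℝ) : ℂ) := by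
    rw [h]
    push_cast
    push_cast at hsq
    rw [hsq]
    ring
  rw [Complex.ofReal_inj] at h1
  rw [h1]
  have : 0 ≤ π * s / 2 * N ^ 2 := by positivity
  linarith

/-! ### The periodization as a function of its scale -/

/-- The function `-x w'(x)` for `w(x) = x sech² x`. -/
def sechRate (x : ℝ) : ℝ := x * sech x ^ 2 * (2 * x * tanh x - 1)

theorem hasDerivAt_sechRate (x : ℝ) : HasDerivAt sechRate
    (-(sech x ^ 2 * (1 - 6 * (x * tanh x) + 6 * (x * tanh x) ^ 2 - 2 * x ^ 2))) x := by
  have ht := hasDerivAt_tanh x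
  have h : HasDerivAt (fun x => x * (1 - tanh x ^ 2) * (2 * x * tanh x - 1)) _ x :=
    ((hasDerivAt_id x).mul ((ht.pow 2).const_sub 1)).mul
      ((((hasDerivAt_id x).const_mul 2).mul ht).sub_const 1)
  have h2 : sechRate = fun x => x * (1 - tanh x ^ 2) * (2 * x * tanh x - 1) := by
    funext t
    rw [sechRate, sech_sq]
  rw [h2]
  refine h.congr_deriv ?_
  simp only [sech_sq, id, Pi.pow_apply, Pi.mul_apply]
  norm_num
  ring

/-- A lower bound for `tanh` on `[a, ∞)` from a lower bound for `exp (2 * a)`. -/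
theorem le_tanh {x a b : ℝ} (hx : a ≤ x) (hab : (1 + b) ≤ (1 - b) * exp (2 * a)) (hb : b ≤ 1) :
    b ≤ tanh x := by
  have h1 : exp (2 * a) ≤ exp x * exp x := by
    rw [← exp_add]
    exact exp_le_exp.2 (by linarith)
  have h2 : (1 + b) ≤ (1 - b) * (exp x * exp x) :=
    hab.trans (mul_le_mul_of_nonneg_left h1 (by linarith))
  rw [tanh_eq_sinh_div_cosh, le_div_iff₀ (cosh_pos x), cosh_eq, sinh_eq]
  have h3 : exp x * exp (-x) = 1 := by rw [← exp_add]; simp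
  have h4 := exp_pos (-x)
  have h5 : (1 + b) * exp (-x) ≤ (1 - b) * exp x := by
    have := mul_le_mul_of_nonneg_right h2 h4.le
    calc (1 + b) * exp (-x) ≤ (1 - b) * (exp x * exp x) * exp (-x) := this
      _ = (1 - b) * exp x * (exp x * exp (-x)) := by ring
      _ = _ := by rw [h3, mul_one]
  linarith

theorem exp_lower_bound (k : ℕ) {x : ℝ} (hx : 0 ≤ x) :
    (2.7 : ℝ) ^ k * (1 + x + x ^ 2 / 2) ≤ exp (k + x) := by
  rw [exp_add, ← exp_one_pow]
  have h1 := quadratic_le_exp_of_nonneg hx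
  have h2 : (2.7 : ℝ) ≤ exp 1 := by linarith [exp_one_gt_d9]
  gcongr

theorem sechRate_strictAntiOn : StrictAntiOn sechRate (Set.Ici 1.7) := by
  refine strictAntiOn_of_deriv_neg (convex_Ici _)
    (fun x _ => (hasDerivAt_sechRate x).continuousAt.continuousWithinAt) fun x hx => ?_
  rw [interior_Ici, Set.mem_Ioi] at hx
  rw [(hasDerivAt_sechRate x).deriv, neg_lt_zero]
  refine mul_pos (pow_pos (sech_pos x) 2) ?_
  have ht : (0.93 : ℝ) ≤ tanh x := by
    refine le_tanh hx.le ?_ (by norm_num)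
    have := exp_lower_bound 3 (x := 0.4) (by norm_num)
    norm_num at this ⊢
    linarith
  have hy : 0.93 * x ≤ x * tanh x := by nlinarith
  have h1 : (1 - 6 * (x * tanh x) + 6 * (x * tanh x) ^ 2 - 2 * x ^ 2)
      = (1 - 6 * (0.93 * x) + 6 * (0.93 * x) ^ 2 - 2 * x ^ 2)
        + 6 * (x * tanh x - 0.93 * x) * (x * tanh x + 0.93 * x - 1) := by ring
  rw [h1]
  have h2 : 0 < 1 - 6 * (0.93 * x) + 6 * (0.93 * x) ^ 2 - 2 * x ^ 2 := by nlinarith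
  have h3 : 0 ≤ 6 * (x * tanh x - 0.93 * x) * (x * tanh x + 0.93 * x - 1) :=
    mul_nonneg (by linarith) (by linarith)
  linarith

theorem tanh_ge_of_ge {x : ℝ} (hx : 1.57 ≤ x) : 0.9 ≤ tanh x := by
  refine le_tanh hx ?_ (by norm_num)
  have := exp_lower_bound 3 (x := 0.14) (by norm_num)
  norm_num at this ⊢
  linarith

theorem sechRate_pos {x : ℝ} (hx : 1.57 ≤ x) : 0 < sechRate x := by
  have ht := tanh_ge_of_ge hx
  exact mul_pos (mul_pos (by linarith) (pow_pos (sech_pos x) 2)) (by nlinarith)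

/-- `sechRate` is not monotone near `π / 2`, but its values there exceed those from `2.85` on. -/
theorem sechRate_lt_of_near {x x' : ℝ} (h1 : 1.57 ≤ x) (h2 : x ≤ 1.73) (h3 : 2.85 ≤ x') :
    sechRate x' < sechRate x := by
  have ha : sechRate x' ≤ sechRate 2.85 :=
    sechRate_strictAntiOn.antitoneOn (by norm_num) (by norm_num; linarith) h3
  have hb : sechRate 2.85 ≤ 2.85 * (4 / 192) * 4.7 := by
    have h4 : sech 2.85 ^ 2 ≤ 4 / 192 := by
      have h5 := sech_le_exp 2.85
      rw [abs_of_pos (by norm_num)] at h5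
      have h6 := pow_le_pow_left₀ (sech_pos 2.85).le h5 2
      refine h6.trans ?_
      rw [mul_pow, ← exp_nat_mul]
      have h7 := exp_lower_bound 5 (x := 0.7) (by norm_num)
      have h8 : exp (((2 : ℕ) : ℝ) * -2.85) = (exp (5.7))⁻¹ := by
        rw [← exp_neg]
        norm_num
      have h9 : (192 : ℝ) ≤ exp 5.7 := by norm_num at h7 ⊢; linarith
      rw [h8, div_eq_mul_inv]
      have := inv_anti₀ (by norm_num) h9
      linarith
    have h5 : tanh 2.85 ≤ 1 := by
      have := sech_sq 2.85
      nlinarith [sq_nonneg (sech 2.85)]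
    have h6 := tanh_ge_of_ge (show (1.57 : ℝ) ≤ 2.85 by norm_num)
    rw [sechRate]
    gcongr
    all_goals linarith
  have hc : 1.57 * 0.1 * 1.8 ≤ sechRate x := by
    have h4 : (0.1 : ℝ) ≤ sech x ^ 2 := by
      have h5 : cosh x ≤ 3.15 := by
        rw [cosh_eq]
        have e1 : exp x ≤ exp 2 / 1.27 := by
          rw [le_div_iff₀ (by norm_num)]
          have : (1.27 : ℝ) ≤ exp 0.27 := by linarith [add_one_le_exp (0.27 : ℝ)]
          calc exp x * 1.27 ≤ exp x * exp 0.27 := by gcongr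
            _ = exp (x + 0.27) := by rw [exp_add]
            _ ≤ exp 2 := exp_le_exp.2 (by linarith)
        have e2 : exp 2 ≤ 7.4 := by
          have : exp 2 = exp 1 ^ 2 := by rw [← exp_nat_mul]; norm_num
          rw [this]
          nlinarith [exp_one_lt_d9, exp_pos 1]
        have e3 : exp (-x) ≤ 1 / 2.57 := by
          rw [exp_neg, one_div]
          exact inv_anti₀ (by norm_num) (by linarith [add_one_le_exp x])
        norm_num at e1 ⊢
        linarith
      have h6 : (3.15 : ℝ)⁻¹ ≤ sech x := inv_anti₀ (cosh_pos x) h5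
      calc (0.1 : ℝ) ≤ (3.15 : ℝ)⁻¹ ^ 2 := by norm_num
        _ ≤ _ := by gcongr
    have h5 := tanh_ge_of_ge h1
    rw [sechRate]
    gcongr
    nlinarith
  have hd : (2.85 * (4 / 192) * 4.7 : ℝ) < 1.57 * 0.1 * 1.8 := by norm_num
  linarith

/-- The series `x ∑_{k ≥ 0} sech² (x (k + θ))`: for `θ = 1/2` and `θ = 1` it carries the dependence of
`halfSum` and `ambiguitySum` on the scale. -/
def sechSqSeries (θ x : ℝ) : ℝ := ∑' k : ℕ, x * sech (x * (k + θ)) ^ 2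

/-- `-x` times the derivative of `sechSqSeries θ`. -/
def sechRateSeries (θ x : ℝ) : ℝ := ∑' k : ℕ, sechRate (x * (k + θ)) / (k + θ)

theorem summable_nat_sech {c : ℝ} (hc : 0 < c) (y : ℝ) :
    Summable fun k : ℕ => sech (c * (k + y)) :=
  (summable_sech hc y).comp_injective (i := fun n : ℕ => (n : ℤ)) Nat.cast_injective

theorem sech_anti {x y : ℝ} (hx : 0 ≤ x) (hxy : x ≤ y) : sech y ≤ sech x :=
  inv_anti₀ (cosh_pos x) (cosh_le_cosh.2 (by rwa [abs_of_nonneg hx, abs_of_nonneg (hx.trans hxy)]))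

theorem mul_sech_le_one (x : ℝ) : x * sech x ≤ 1 := by
  rw [sech, ← div_eq_mul_inv, div_le_one (cosh_pos x)]
  have h1 : exp x = exp (x - 1) * exp 1 := by rw [← exp_add, sub_add_cancel]
  have h2 : (2 : ℝ) ≤ exp 1 := by linarith [exp_one_gt_d9]
  have h3 : x ≤ exp (x - 1) := by linarith [add_one_le_exp (x - 1)]
  rw [cosh_eq]
  nlinarith [exp_pos (-x), exp_pos (x - 1)]

theorem abs_tanh_le_one (x : ℝ) : |tanh x| ≤ 1 := by
  rw [← sq_le_one_iff_abs_le_one]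
  have := sech_sq x
  nlinarith [sq_nonneg (sech x)]

theorem sechSq_term_bound {c x y : ℝ} (hc : 0 < c) (hx : 0 < x) (h1 : x / 2 < y) (h2 : y < 2 * x) :
    |sech (y * c) ^ 2 * (1 - 2 * (y * c) * tanh (y * c))| ≤ 9 * sech (x / 2 * c) := by
  have hy : 0 < y := by linarith
  have ht := abs_tanh_le_one (y * c)
  have hs : sech (y * c) ≤ sech (x / 2 * c) := sech_anti (by positivity) (by gcongr)
  have hm := mul_sech_le_one (x / 2 * c)
  have hp := sech_pos (x / 2 * c)
  have hp1 := sech_le_one (x / 2 * c)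
  have h3 : |1 - 2 * (y * c) * tanh (y * c)| ≤ 1 + 4 * (x * c) := by
    refine (abs_sub _ _).trans ?_
    rw [abs_one, abs_mul, abs_of_pos (by positivity : (0 : ℝ) < 2 * (y * c))]
    have : 2 * (y * c) * |tanh (y * c)| ≤ 2 * (y * c) * 1 := by gcongr
    nlinarith
  rw [abs_mul, abs_of_nonneg (by positivity)]
  calc sech (y * c) ^ 2 * |1 - 2 * (y * c) * tanh (y * c)|
      ≤ sech (x / 2 * c) ^ 2 * (1 + 4 * (x * c)) := by
        gcongr
        exact (sech_pos _).le
    _ = sech (x / 2 * c) * (sech (x / 2 * c) + 8 * (x / 2 * c * sech (x / 2 * c))) := by ring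
    _ ≤ sech (x / 2 * c) * (1 + 8 * 1) := by gcongr
    _ = _ := by ring

theorem hasDerivAt_sech (x : ℝ) : HasDerivAt sech (-(sech x * tanh x)) x := by
  have h := (hasDerivAt_cosh x).inv (cosh_pos x).ne'
  refine h.congr_deriv ?_
  rw [tanh_eq_sinh_div_cosh]
  unfold sech
  have := (cosh_pos x).ne'
  field_simp

theorem hasDerivAt_mul_sech_sq (c x : ℝ) : HasDerivAt (fun x => x * sech (x * c) ^ 2)
    (sech (x * c) ^ 2 * (1 - 2 * (x * c) * tanh (x * c))) x := by
  have h1 : HasDerivAt (fun x => sech (x * c)) (-(sech (x * c) * tanh (x * c)) * c) x :=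
    HasDerivAt.comp (h₂ := sech) (h := fun x => x * c) x (hasDerivAt_sech (x * c))
      (hasDerivAt_mul_const c)
  refine ((hasDerivAt_id x).mul (h1.pow 2)).congr_deriv ?_
  simp only [id, Pi.pow_apply]
  norm_num
  ring

theorem sechRate_div {c x : ℝ} (hc : c ≠ 0) : sechRate (x * c) / c
    = -x * (sech (x * c) ^ 2 * (1 - 2 * (x * c) * tanh (x * c))) := by
  rw [sechRate]
  field_simp
  ring

theorem summable_sechRate {θ x : ℝ} (hθ : 0 < θ) (hx : 0 < x) :
    Summable fun k : ℕ => sechRate (x * (k + θ)) / (k + θ) := by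
  have hc : ∀ k : ℕ, 0 < (k : ℝ) + θ := fun k => by positivity
  simp only [sechRate_div (hc _).ne']
  refine Summable.mul_left _ (Summable.of_norm_bounded
    ((summable_nat_sech (half_pos hx) θ).mul_left 9) fun k => ?_)
  exact sechSq_term_bound (hc k) hx (by linarith) (by linarith)

theorem hasDerivAt_sechSqSeries {θ x : ℝ} (hθ : 0 < θ) (hx : 0 < x) :
    HasDerivAt (sechSqSeries θ) (-sechRateSeries θ x / x) x := by
  have hc : ∀ k : ℕ, 0 < (k : ℝ) + θ := fun k => by positivity
  have hmem : x ∈ Set.Ioo (x / 2) (2 * x) := ⟨by linarith, by linarith⟩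
  have hs0 : Summable fun k : ℕ => x * sech (x * (k + θ)) ^ 2 :=
    ((summable_sech_sq hx θ).comp_injective (i := fun n : ℕ => (n : ℤ))
      Nat.cast_injective).mul_left x
  have h := hasDerivAt_tsum_of_isPreconnected (𝕜 := ℝ) (t := Set.Ioo (x / 2) (2 * x))
    (g := fun (k : ℕ) x => x * sech (x * (k + θ)) ^ 2)
    (g' := fun (k : ℕ) x => sech (x * (k + θ)) ^ 2 * (1 - 2 * (x * (k + θ)) * tanh (x * (k + θ))))
    ((summable_nat_sech (half_pos hx) θ).mul_left 9) isOpen_Ioo isPreconnected_Ioo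
    (fun k y _ => hasDerivAt_mul_sech_sq _ y)
    (fun k y hy => sechSq_term_bound (hc k) hx hy.1 hy.2) hmem hs0 hmem
  refine h.congr_deriv ?_
  simp only [sechRateSeries, sechRate_div (hc _).ne', tsum_mul_left]
  rw [neg_mul, neg_neg, mul_div_cancel_left₀ _ hx.ne']

theorem sechSqSum_half {c : ℝ} (hc : 0 < c) :
    sechSqSum c (1 / 2) = 2 * ∑' k : ℕ, sech (c * (k + 1 / 2)) ^ 2 := by
  have hs := summable_sech_sq hc (1 / 2)
  have h1 : Summable fun n : ℕ => sech (c * (((n : ℤ) : ℝ) + 1 / 2)) ^ 2 :=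
    hs.comp_injective (i := fun n : ℕ => (n : ℤ)) Nat.cast_injective
  have h2 : Summable fun n : ℕ => sech (c * (((-((n : ℤ) + 1) : ℤ) : ℝ) + 1 / 2)) ^ 2 :=
    hs.comp_injective (i := fun n : ℕ => (-((n : ℤ) + 1) : ℤ)) fun m n h => by simpa using h
  have h3 := tsum_of_nat_of_neg_add_one (f := fun k : ℤ => sech (c * (k + 1 / 2)) ^ 2) h1 h2
  rw [sechSqSum, h3, two_mul]
  congr 1
  refine tsum_congr fun k => ?_
  rw [← sech_neg]
  push_cast
  ring_nf

theorem halfSum_eq {s : ℝ} (hs : 0 < s) : halfSum s = sechSqSeries (1 / 2) (π * s) := by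
  rw [halfSum, sechSqSum_half (mul_pos pi_pos hs), sechSqSeries, tsum_mul_left]
  ring

theorem tsum_int_even {f : ℤ → ℝ} (hf : Summable f) (he : ∀ k, f (-k) = f k) :
    ∑' k, f k = f 0 + 2 * ∑' k : ℕ, f (k + 1) := by
  have h1 : Summable fun n : ℕ => f ((n : ℤ) + 1) :=
    hf.comp_injective (i := fun n : ℕ => (n : ℤ) + 1) fun m n h => by simpa using h
  have h2 : Summable fun n : ℕ => f (-((n : ℤ) + 1)) := by simpa only [he] using h1
  rw [tsum_of_add_one_of_neg_add_one h1 h2]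
  simp only [he]
  ring

theorem ambiguitySum_eq_sech {s : ℝ} (hs : 0 < s) :
    ambiguitySum s = (π / s) / 2 + sechSqSeries 1 (π / s) := by
  have hc : 0 < π / s := div_pos pi_pos hs
  rw [ambiguitySum_eq hs, sechSqSum, tsum_int_even (summable_sech_sq hc 0), sechSqSeries,
    tsum_mul_left]
  · simp [sech]
    field_simp
  · intro k
    rw [← sech_neg]
    push_cast
    ring_nf

/-! ### Optimization over the scale -/

/-- Minimization of `F(α) + F(ν² / α)`, where `M(s) = s F'(s)` is the derivative of `F` with respect to
`log s`. -/
theorem two_mul_lt_of_logScaleDeriv {F M : ℝ → ℝ} (hF : ∀ s, 0 < s → HasDerivAt F (M s / s) s)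
    {ν : ℝ} (hν : 0 < ν) (hM : ∀ α, ν < α → M (ν ^ 2 / α) < M α) {α : ℝ} (hα : 0 < α)
    (hne : α ≠ ν) : 2 * F ν < F α + F (ν ^ 2 / α) := by
  have hd : ∀ α, 0 < α → HasDerivAt (fun α => F α + F (ν ^ 2 / α))
      ((M α - M (ν ^ 2 / α)) / α) α := by
    intro α hα
    have hpos : 0 < ν ^ 2 / α := by positivity
    have h1 : HasDerivAt (fun α => ν ^ 2 / α) (-(ν ^ 2 / α ^ 2)) α := by
      have := (hasDerivAt_inv hα.ne').const_mul (ν ^ 2)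
      refine this.congr_deriv ?_
      field_simp
    refine ((hF α hα).add ((hF _ hpos).comp α h1)).congr_deriv ?_
    field_simp
    ring
  have hmono : StrictMonoOn (fun α => F α + F (ν ^ 2 / α)) (Set.Ici ν) := by
    refine strictMonoOn_of_deriv_pos (convex_Ici _)
      (fun α h => (hd α (hν.trans_le h)).continuousAt.continuousWithinAt) fun α h => ?_
    rw [interior_Ici, Set.mem_Ioi] at h
    rw [(hd α (hν.trans h)).deriv]
    exact div_pos (sub_pos.2 (hM α h)) (hν.trans h)
  have hself : ν ^ 2 / ν = ν := by field_simp
  have key : ∀ α, ν < α → 2 * F ν < F α + F (ν ^ 2 / α) := by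
    intro α h
    have := hmono Set.self_mem_Ici h.le h
    simp only [hself] at this
    linarith
  rcases lt_or_gt_of_ne hne with h | h
  · have h1 : ν < ν ^ 2 / α := by
      rw [lt_div_iff₀ hα]
      nlinarith
    have := key _ h1
    rw [show ν ^ 2 / (ν ^ 2 / α) = α by field_simp] at this
    linarith
  · exact key α h

theorem sechRateSeries_one_strictAntiOn : StrictAntiOn (sechRateSeries 1) (Set.Ici 1.7) := by
  intro x hx x' hx' hlt
  rw [Set.mem_Ici] at hx hx'
  have h : ∀ k : ℕ, sechRate (x' * (k + 1)) / (k + 1) < sechRate (x * (k + 1)) / (k + 1) := by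
    intro k
    have hk : (1 : ℝ) ≤ k + 1 := by linarith [(Nat.cast_nonneg k : (0 : ℝ) ≤ k)]
    refine div_lt_div_of_pos_right (sechRate_strictAntiOn ?_ ?_ ?_) (by linarith)
    · rw [Set.mem_Ici]; nlinarith
    · rw [Set.mem_Ici]; nlinarith
    · nlinarith
  exact Summable.tsum_lt_tsum (fun k => (h k).le) (h 0)
    (summable_sechRate one_pos (by linarith)) (summable_sechRate one_pos (by linarith))

/-- A termwise comparison. The term `k = 0` has its argument in the monotone range of `sechRate` only
if `3.4 ≤ x`; the other alternative is the numerical one. -/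
theorem sechRateSeries_half_lt {x x' : ℝ} (h1 : 3.14 ≤ x) (hlt : x < x')
    (h2 : 3.4 ≤ x ∨ (x ≤ 3.46 ∧ 5.7 ≤ x')) :
    sechRateSeries (1 / 2) x' < sechRateSeries (1 / 2) x := by
  have h : ∀ k : ℕ, sechRate (x' * (k + 1 / 2)) / (k + 1 / 2)
      < sechRate (x * (k + 1 / 2)) / (k + 1 / 2) := by
    intro k
    have hk : (0 : ℝ) ≤ k := Nat.cast_nonneg k
    refine div_lt_div_of_pos_right ?_ (by linarith)
    rcases Nat.eq_zero_or_pos k with rfl | hk1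
    · rcases h2 with h2 | h2
      · refine sechRate_strictAntiOn ?_ ?_ ?_
        · rw [Set.mem_Ici, Nat.cast_zero]; linarith
        · rw [Set.mem_Ici, Nat.cast_zero]; linarith
        · rw [Nat.cast_zero]; linarith
      · rw [Nat.cast_zero]
        exact sechRate_lt_of_near (by linarith) (by linarith) (by linarith)
    · have hk2 : (1 : ℝ) ≤ k := by exact_mod_cast hk1
      refine sechRate_strictAntiOn ?_ ?_ ?_
      · rw [Set.mem_Ici]; nlinarith
      · rw [Set.mem_Ici]; nlinarith
      · nlinarith
  exact Summable.tsum_lt_tsum (fun k => (h k).le) (h 0)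
    (summable_sechRate (by norm_num) (by linarith)) (summable_sechRate (by norm_num) (by linarith))

theorem hasDerivAt_halfSum {s : ℝ} (hs : 0 < s) :
    HasDerivAt halfSum (-sechRateSeries (1 / 2) (π * s) / s) s := by
  have hπs := mul_pos pi_pos hs
  have h1 := (hasDerivAt_sechSqSeries (θ := 1 / 2) (by norm_num) hπs).comp s
    (hasDerivAt_const_mul π)
  have h2 : halfSum =ᶠ[𝓝 s] sechSqSeries (1 / 2) ∘ fun s => π * s := by
    filter_upwards [lt_mem_nhds hs] with t ht
    exact halfSum_eq ht
  refine (h1.congr_of_eventuallyEq h2).congr_deriv ?_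
  field_simp

/-- The derivative of `halfSum_inv`. -/
theorem sechRateSeries_half_inv {s : ℝ} (hs : 0 < s) :
    sechRateSeries (1 / 2) (π * s⁻¹) = sechRateSeries (1 / 2) (π * s) := by
  have h1 := (hasDerivAt_halfSum (inv_pos.2 hs)).comp s (hasDerivAt_inv hs.ne')
  have h2 : (halfSum ∘ fun s => s⁻¹) =ᶠ[𝓝 s] fun s => 1 - halfSum s := by
    filter_upwards [lt_mem_nhds hs] with t ht
    exact halfSum_inv ht
  have h3 := (h1.congr_of_eventuallyEq h2.symm).unique ((hasDerivAt_halfSum hs).const_sub 1)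
  field_simp at h3
  simpa only [div_eq_mul_inv] using h3

theorem sechRateSeries_half_pos {s : ℝ} (hs : 0 < s) : 0 < sechRateSeries (1 / 2) (π * s) := by
  have key : ∀ s : ℝ, 1 ≤ s → 0 < sechRateSeries (1 / 2) (π * s) := by
    intro s hs
    have hx : 3.14 ≤ π * s := by nlinarith [pi_gt_d2]
    have h : ∀ k : ℕ, 0 < sechRate (π * s * (k + 1 / 2)) / (k + 1 / 2) := by
      intro k
      have hk : (0 : ℝ) ≤ k := Nat.cast_nonneg k
      exact div_pos (sechRate_pos (by nlinarith)) (by linarith)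
    exact (summable_sechRate (by norm_num) (by linarith)).tsum_pos (fun k => (h k).le) 0 (h 0)
  rcases le_total 1 s with h | h
  · exact key s h
  · rw [← sechRateSeries_half_inv hs]
    exact key _ ((one_le_inv₀ hs).2 h)

theorem halfSum_strictAntiOn : StrictAntiOn halfSum (Set.Ioi 0) := by
  refine strictAntiOn_of_deriv_neg (convex_Ioi _)
    (fun s h => (hasDerivAt_halfSum h).continuousAt.continuousWithinAt) fun s h => ?_
  rw [interior_Ioi, Set.mem_Ioi] at h
  rw [(hasDerivAt_halfSum h).deriv, neg_div, neg_lt_zero]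
  exact div_pos (sechRateSeries_half_pos h) h

theorem two_mul_halfSum_lt {ν : ℝ} (hν : 0 < ν) (hν2 : 2 ≤ ν ^ 2) {α : ℝ} (hα : 0 < α)
    (hne : α ≠ ν) : 2 * halfSum ν < halfSum α + halfSum (ν ^ 2 / α) := by
  refine two_mul_lt_of_logScaleDeriv (M := fun s => -sechRateSeries (1 / 2) (π * s))
    (fun s hs => hasDerivAt_halfSum hs) hν (fun α hlt => ?_) hα hne
  have hα : 0 < α := hν.trans hlt
  rw [neg_lt_neg_iff]
  have hσ : 0 < ν ^ 2 / α := by positivity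
  have hσα : ν ^ 2 / α < α := by
    rw [div_lt_iff₀ hα]
    nlinarith
  have hα1 : 1 < α := by nlinarith
  have p1 := pi_gt_d2
  have p2 := pi_lt_d4
  -- `σ` is `ν² / α` or its inverse, whichever is at least `1`
  have key : ∀ σ : ℝ, 1 ≤ σ → σ < α → 2 ≤ σ * α →
      sechRateSeries (1 / 2) (π * α) < sechRateSeries (1 / 2) (π * σ) := by
    intro σ h1 h2 h3
    refine sechRateSeries_half_lt (by nlinarith) (by nlinarith) ?_
    rcases le_or_gt 1.1 σ with h4 | h4
    · left; nlinarith
    · right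
      have : 2 / 1.1 ≤ α := by
        rw [div_le_iff₀ (by norm_num)]
        nlinarith
      norm_num at this
      constructor <;> nlinarith
  rcases le_total 1 (ν ^ 2 / α) with h | h
  · exact key _ h hσα (by rw [div_mul_cancel₀ _ hα.ne']; exact hν2)
  · rw [← sechRateSeries_half_inv hσ]
    refine key _ ((one_le_inv₀ hσ).2 h) ?_ ?_
    · rw [inv_div, div_lt_iff₀ (by positivity)]
      nlinarith
    · have h5 : 2 ≤ α := by
        rw [div_le_one hα] at h
        linarith
      nlinarith [(one_le_inv₀ hσ).2 h]

/-- The function `y v'(y)` for `v(y) = y / sinh y`. -/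
def sinhRate (y : ℝ) : ℝ := y * ((sinh y - y * cosh y) / sinh y ^ 2)

theorem hasDerivAt_sinhRate {y : ℝ} (hy : 0 < y) : HasDerivAt sinhRate
    ((sinh y ^ 2 - 3 * (y * cosh y) * sinh y + 2 * (y * cosh y) ^ 2 - y ^ 2 * sinh y ^ 2)
      / sinh y ^ 3) y := by
  have hs : sinh y ≠ 0 := (sinh_pos_iff.2 hy).ne'
  have h := (hasDerivAt_id y).mul (((hasDerivAt_sinh y).sub
    ((hasDerivAt_id y).mul (hasDerivAt_cosh y))).div ((hasDerivAt_sinh y).pow 2) (pow_ne_zero 2 hs))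
  refine h.congr_deriv ?_
  simp only [id, Pi.pow_apply, Pi.mul_apply, Pi.sub_apply, Pi.div_apply]
  field_simp
  norm_num
  ring

theorem sinhRate_strictMonoOn : StrictMonoOn sinhRate (Set.Ici 3) := by
  refine strictMonoOn_of_deriv_pos (convex_Ici _)
    (fun y h => ContinuousAt.continuousWithinAt (hasDerivAt_sinhRate ?_).continuousAt)
    fun y hy => ?_
  · rw [Set.mem_Ici] at h
    linarith
  rw [interior_Ici, Set.mem_Ioi] at hy
  have h0 : 0 < y := by linarith
  rw [(hasDerivAt_sinhRate h0).deriv]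
  have hs := sinh_pos_iff.2 h0
  refine div_pos ?_ (pow_pos hs 3)
  have hc := sinh_lt_cosh y
  have h1 : sinh y ^ 2 - 3 * (y * cosh y) * sinh y + 2 * (y * cosh y) ^ 2 - y ^ 2 * sinh y ^ 2
      = sinh y ^ 2 * (1 - 3 * y + y ^ 2)
        + y * (cosh y - sinh y) * (2 * y * (cosh y + sinh y) - 3 * sinh y) := by ring
  rw [h1]
  have h2 : 0 < 1 - 3 * y + y ^ 2 := by nlinarith
  have h3 : 0 < 2 * y * (cosh y + sinh y) - 3 * sinh y := by nlinarith
  have h4 : 0 < cosh y - sinh y := by linarith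
  positivity

theorem hasDerivAt_div_sinh {y : ℝ} (hy : 0 < y) :
    HasDerivAt (fun y => y / sinh y) ((sinh y - y * cosh y) / sinh y ^ 2) y := by
  refine ((hasDerivAt_id y).div (hasDerivAt_sinh y) (sinh_pos_iff.2 hy).ne').congr_deriv ?_
  simp

theorem sinh_term_bound {c x y : ℝ} (hc : 1 ≤ c) (hx : 0 < x) (h1 : x / 2 < y) (h2 : y < 2 * x) :
    |c * ((sinh (y * c) - y * c * cosh (y * c)) / sinh (y * c) ^ 2)|
      ≤ 2 * (1 + 2 * x) / tanh (x / 2) ^ 2 * (c ^ 2 * exp (-(x / 2) * c)) := by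
  have hy : 0 < y := by linarith
  have ht0 : 0 < tanh (x / 2) := by
    rw [tanh_eq_sinh_div_cosh]
    exact div_pos (sinh_pos_iff.2 (by linarith)) (cosh_pos _)
  have hyc : x / 2 * c ≤ y * c := by gcongr
  have hyc' : x / 2 ≤ y * c := by nlinarith
  set t := y * c with ht
  have htpos : 0 < t := by positivity
  have hsinh := sinh_pos_iff.2 htpos
  have hcosh := cosh_pos t
  have hτ : tanh (x / 2) * cosh t ≤ sinh t := by
    have : 0 ≤ sinh (t - x / 2) := sinh_nonneg_iff.2 (by linarith)
    rw [sinh_sub] at this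
    rw [tanh_eq_sinh_div_cosh, div_mul_eq_mul_div, div_le_iff₀ (cosh_pos _)]
    linarith
  have h3 : |sinh t - t * cosh t| ≤ (1 + t) * cosh t := by
    refine (abs_sub _ _).trans ?_
    rw [abs_of_pos hsinh, abs_of_pos (by positivity)]
    linarith [sinh_lt_cosh t]
  have h4 : sech t ≤ 2 * exp (-(x / 2) * c) := by
    refine (sech_le_exp t).trans ?_
    rw [abs_of_pos htpos]
    gcongr
    linarith
  have h5 : |sinh t - t * cosh t| / sinh t ^ 2 ≤ (1 + t) * sech t / tanh (x / 2) ^ 2 := by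
    calc |sinh t - t * cosh t| / sinh t ^ 2
        ≤ (1 + t) * cosh t / (tanh (x / 2) * cosh t) ^ 2 := by gcongr
      _ = (1 + t) * sech t / tanh (x / 2) ^ 2 := by
        unfold sech
        field_simp
  rw [abs_mul, abs_div, abs_of_pos (by linarith : 0 < c),
    abs_of_pos (by positivity : 0 < sinh t ^ 2)]
  have h6 : 1 + t ≤ c * (1 + 2 * x) := by
    rw [ht]
    nlinarith
  calc c * (|sinh t - t * cosh t| / sinh t ^ 2)
      ≤ c * ((1 + t) * sech t / tanh (x / 2) ^ 2) := by gcongr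
    _ ≤ c * ((c * (1 + 2 * x)) * (2 * exp (-(x / 2) * c)) / tanh (x / 2) ^ 2) := by
        have := sech_pos t
        gcongr
    _ = _ := by ring

theorem summable_sq_mul_exp {x : ℝ} (hx : 0 < x) :
    Summable fun k : ℕ => ((k : ℝ) + 1) ^ 2 * exp (-(x / 2) * (k + 1)) := by
  have h := (summable_nat_add_iff 1).2 (summable_pow_mul_exp_neg_nat_mul 2 (half_pos hx))
  refine h.congr fun k => ?_
  push_cast
  rfl

theorem hasDerivAt_tsum_div_sinh {x : ℝ} (hx : 0 < x) :
    HasDerivAt (fun x => ∑' k : ℕ, x * (k + 1) / sinh (x * (k + 1)))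
      ((∑' k : ℕ, sinhRate (x * (k + 1))) / x) x := by
  have hmem : x ∈ Set.Ioo (x / 2) (2 * x) := ⟨by linarith, by linarith⟩
  have hc : ∀ k : ℕ, (1 : ℝ) ≤ k + 1 := fun k => by linarith [(Nat.cast_nonneg k : (0 : ℝ) ≤ k)]
  have hs0 : Summable fun k : ℕ => x * (k + 1) / sinh (x * (k + 1)) := by
    have h := (summable_kap hx).comp_injective (i := fun n : ℕ => (n : ℤ) + 1)
      fun m n h => by simpa using h
    refine (h.mul_left (x / 2)).congr fun k => ?_
    simp only [Function.comp, kap]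
    push_cast
    ring
  have h := hasDerivAt_tsum_of_isPreconnected (𝕜 := ℝ) (t := Set.Ioo (x / 2) (2 * x))
    (g := fun (k : ℕ) x => x * (k + 1) / sinh (x * (k + 1)))
    (g' := fun (k : ℕ) x => (k + 1) * ((sinh (x * (k + 1)) - x * (k + 1) * cosh (x * (k + 1)))
      / sinh (x * (k + 1)) ^ 2))
    ((summable_sq_mul_exp hx).mul_left (2 * (1 + 2 * x) / tanh (x / 2) ^ 2))
    isOpen_Ioo isPreconnected_Ioo
    (fun k y hy => by
      have hy0 : 0 < y := by linarith [hy.1]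
      have := HasDerivAt.comp (h₂ := fun y => y / sinh y) (h := fun y => y * ((k : ℝ) + 1)) y
        (hasDerivAt_div_sinh (by have := hc k; positivity)) (hasDerivAt_mul_const _)
      refine this.congr_deriv ?_
      ring)
    (fun k y hy => sinh_term_bound (hc k) hx hy.1 hy.2) hmem hs0 hmem
  refine h.congr_deriv ?_
  rw [← tsum_div_const]
  refine tsum_congr fun k => ?_
  rw [sinhRate]
  field_simp

theorem summable_sinhRate {x : ℝ} (hx : 0 < x) :
    Summable fun k : ℕ => sinhRate (x * (k + 1)) := by
  have hc : ∀ k : ℕ, (1 : ℝ) ≤ k + 1 := fun k => by linarith [(Nat.cast_nonneg k : (0 : ℝ) ≤ k)]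
  have h : Summable fun k : ℕ => ((k : ℝ) + 1) *
      ((sinh (x * (k + 1)) - x * (k + 1) * cosh (x * (k + 1))) / sinh (x * (k + 1)) ^ 2) :=
    Summable.of_norm_bounded
      ((summable_sq_mul_exp hx).mul_left (2 * (1 + 2 * x) / tanh (x / 2) ^ 2))
      fun k => sinh_term_bound (hc k) hx (by linarith) (by linarith)
  refine (h.mul_left x).congr fun k => ?_
  rw [sinhRate]
  ring

theorem ambiguitySum_eq_sinh {s : ℝ} (hs : 0 < s) :
    ambiguitySum s = 1 + 2 * ∑' k : ℕ, π * s * (k + 1) / sinh (π * s * (k + 1)) := by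
  rw [ambiguitySum, tsum_int_even (summable_kap (mul_pos pi_pos hs)) (kap_neg _), kap_zero,
    zero_add, mul_left_comm, ← tsum_mul_left]
  congr 2
  refine tsum_congr fun k => ?_
  rw [kap]
  push_cast
  ring

/-- The function `s H'(s)`, written through the Poisson dual of `H`, whose terms are monotone for
`s ≤ 1`. -/
def ambiguityRate (s : ℝ) : ℝ := -(π / s) / 2 + sechRateSeries 1 (π / s)

theorem hasDerivAt_ambiguitySum {s : ℝ} (hs : 0 < s) :
    HasDerivAt ambiguitySum (ambiguityRate s / s) s := by
  have hπs : 0 < π / s := div_pos pi_pos hs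
  have h0 : HasDerivAt (fun s => π / s) (-(π / s ^ 2)) s := by
    refine ((hasDerivAt_inv hs.ne').const_mul π).congr_deriv ?_
    field_simp
  have h1 := (h0.div_const 2).add ((hasDerivAt_sechSqSeries (θ := 1) one_pos hπs).comp s h0)
  have h2 : ambiguitySum =ᶠ[𝓝 s] (fun s => π / s / 2) + sechSqSeries 1 ∘ fun s => π / s := by
    filter_upwards [lt_mem_nhds hs] with t ht
    exact ambiguitySum_eq_sech ht
  refine (h1.congr_of_eventuallyEq h2).congr_deriv ?_
  rw [ambiguityRate]
  have := pi_pos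
  field_simp

/-- The same function from the series defining `H`, whose terms are monotone for `1 ≤ s`. -/
theorem ambiguityRate_eq {s : ℝ} (hs : 0 < s) :
    ambiguityRate s = 2 * ∑' k : ℕ, sinhRate (π * s * (k + 1)) := by
  have hπs := mul_pos pi_pos hs
  have h1 := (((hasDerivAt_tsum_div_sinh hπs).comp s
    (hasDerivAt_const_mul π)).const_mul 2).const_add 1
  have h2 : ambiguitySum =ᶠ[𝓝 s] fun s =>
      1 + 2 * ((fun x => ∑' k : ℕ, x * (k + 1) / sinh (x * (k + 1))) ∘ fun s => π * s) s := by
    filter_upwards [lt_mem_nhds hs] with t ht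
    exact ambiguitySum_eq_sinh ht
  have h3 := (hasDerivAt_ambiguitySum hs).unique (h1.congr_of_eventuallyEq h2)
  have := pi_pos
  field_simp at h3
  rwa [mul_comm π s]

theorem ambiguityRate_strictMonoOn : StrictMonoOn ambiguityRate (Set.Ioi 0) := by
  have p := pi_gt_three
  have hlow : StrictMonoOn ambiguityRate (Set.Ioc 0 1) := by
    intro s hs t ht hst
    have h1 : π / t < π / s := div_lt_div_of_pos_left pi_pos hs.1 hst
    have h2 : π ≤ π / t := by
      rw [le_div_iff₀ ht.1]
      nlinarith [ht.2]
    have h3 := sechRateSeries_one_strictAntiOn (a := π / t) (b := π / s)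
      (by rw [Set.mem_Ici]; linarith) (by rw [Set.mem_Ici]; linarith) h1
    rw [ambiguityRate, ambiguityRate]
    linarith
  have hhigh : StrictMonoOn ambiguityRate (Set.Ici 1) := by
    intro s hs t ht hst
    rw [Set.mem_Ici] at hs ht
    have hs0 : 0 < s := by linarith
    have ht0 : 0 < t := by linarith
    rw [ambiguityRate_eq hs0, ambiguityRate_eq ht0]
    have h : ∀ k : ℕ, sinhRate (π * s * (k + 1)) < sinhRate (π * t * (k + 1)) := by
      intro k
      have hk : (1 : ℝ) ≤ k + 1 := by linarith [(Nat.cast_nonneg k : (0 : ℝ) ≤ k)]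
      have h1 : 3 ≤ π * s := by nlinarith
      have h2 : π * s < π * t := by gcongr
      refine sinhRate_strictMonoOn ?_ ?_ ?_
      · rw [Set.mem_Ici]; nlinarith
      · rw [Set.mem_Ici]; nlinarith
      · nlinarith
    have := Summable.tsum_lt_tsum (fun k => (h k).le) (h 0)
      (summable_sinhRate (mul_pos pi_pos hs0)) (summable_sinhRate (mul_pos pi_pos ht0))
    linarith
  rw [← Set.Ioc_union_Ici_eq_Ioi one_pos]
  exact hlow.union hhigh (isGreatest_Ioc one_pos) isLeast_Ici

theorem two_mul_ambiguitySum_lt {ν : ℝ} (hν : 0 < ν) {α : ℝ} (hα : 0 < α) (hne : α ≠ ν) :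
    2 * ambiguitySum ν < ambiguitySum α + ambiguitySum (ν ^ 2 / α) := by
  refine two_mul_lt_of_logScaleDeriv (fun s hs => hasDerivAt_ambiguitySum hs) hν
    (fun α hlt => ?_) hα hne
  have hα : 0 < α := hν.trans hlt
  refine ambiguityRate_strictMonoOn (show 0 < ν ^ 2 / α by positivity) hα ?_
  rw [div_lt_iff₀ hα]
  nlinarith

/-! ### The frame operator on compactly supported functions -/

/-- Unfolding an integral over `ℝ` onto a period; the finite set `J` holds all the translates that
matter. -/
theorem integral_eq_intervalIntegral_sum {E : Type*} [NormedAddCommGroup E] [NormedSpace ℝ E]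
    {G : ℝ → E} (hG : Integrable G) (τ : ℝ) {J : Finset ℤ}
    (hJ : ∀ t ∈ Set.Ioc τ (τ + 1), ∀ j ∉ J, G (t + j) = 0) :
    ∫ t, G t = ∫ t in τ..τ + 1, ∑ j ∈ J, G (t + j) := by
  have h := hG.hasSum_intervalIntegral τ
  have h1 : ∀ j : ℤ, ∫ t in τ + j..τ + j + 1, G t = ∫ t in τ..τ + 1, G (t + j) := by
    intro j
    rw [intervalIntegral.integral_comp_add_right]
    congr 1
    ring
  simp only [h1] at h
  have h2 : ∀ j ∉ J, ∫ t in τ..τ + 1, G (t + j) = 0 := by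
    intro j hj
    rw [intervalIntegral.integral_of_le (by linarith)]
    exact setIntegral_eq_zero_of_forall_eq_zero fun t ht => hJ t ht j hj
  rw [h.unique (hasSum_sum_of_ne_finset_zero h2), intervalIntegral.integral_finsetSum]
  exact fun j _ => (hG.comp_add_right (j : ℝ)).intervalIntegrable

theorem integral_eq_mul_intervalIntegral_sum {u : ℝ → ℝ} (hu : Integrable u) {L : ℝ} (hL : 0 < L)
    (τ : ℝ) {J : Finset ℤ} (hJ : ∀ t ∈ Set.Ioc τ (τ + 1), ∀ j ∉ J, u (L * (t + j)) = 0) :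
    ∫ t, u t = L * ∫ t in τ..τ + 1, ∑ j ∈ J, u (L * (t + j)) := by
  rw [← integral_eq_intervalIntegral_sum (G := fun t => u (L * t)) (hu.comp_mul_left' hL.ne') τ hJ,
    Measure.integral_comp_mul_left, abs_of_pos (inv_pos.2 hL), smul_eq_mul,
    mul_inv_cancel_left₀ hL.ne']

/-- Parseval's identity for the periodization `∑ⱼ h(L(t + j))`. -/
theorem hasSum_sq_norm_integral_mul_exp {h : ℝ → ℂ} (hc : Continuous h) (hi : Integrable h)
    {L : ℝ} (hL : 0 < L) (τ : ℝ) {J : Finset ℤ}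
    (hJ : ∀ t ∈ Set.Ioc τ (τ + 1), ∀ j ∉ J, h (L * (t + j)) = 0) :
    HasSum (fun l : ℤ => ‖∫ t, h t * Complex.exp (-(2 * π * Complex.I * l * t / L))‖ ^ 2)
      (L ^ 2 * ∫ t in τ..τ + 1, ‖∑ j ∈ J, h (L * (t + j))‖ ^ 2) := by
  have hlt : τ < τ + 1 := by linarith
  have hF : Continuous fun t => ∑ j ∈ J, h (L * (t + j)) := by fun_prop
  have hmem : MemLp (fun t => ∑ j ∈ J, h (L * (t + j))) 2
      (volume.restrict (Set.Ioc τ (τ + 1))) := by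
    obtain ⟨C, hC⟩ := (isCompact_Icc (a := τ) (b := τ + 1)).exists_bound_of_continuousOn
      hF.continuousOn
    refine MemLp.of_bound hF.aestronglyMeasurable C ?_
    exact (ae_restrict_iff' measurableSet_Ioc).2
      (.of_forall fun t ht => hC t (Set.Ioc_subset_Icc_self ht))
  have hP := (hasSum_sq_fourierCoeffOn hlt hmem).mul_left (L ^ 2)
  have hL' : (L : ℂ) ≠ 0 := by exact_mod_cast hL.ne'
  have hcoef : ∀ l : ℤ, ∫ t, h t * Complex.exp (-(2 * π * Complex.I * l * t / L))
      = L * fourierCoeffOn hlt (fun t => ∑ j ∈ J, h (L * (t + j))) l := by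
    intro l
    let G : ℝ → ℂ := fun t => h (L * t) * Complex.exp (-(2 * π * Complex.I * l * t))
    have hGi : Integrable G := by
      refine (hi.comp_mul_left' hL.ne').mul_bdd (c := 1) ?_ ?_
      · exact Continuous.aestronglyMeasurable (by fun_prop)
      · refine .of_forall fun t => le_of_eq ?_
        rw [show (-(2 * π * Complex.I * l * t) : ℂ) = ((-(2 * π * l * t) : ℝ) : ℂ) * Complex.I by
          push_cast; ring]
        exact Complex.norm_exp_ofReal_mul_I _
    have h1 : ∫ t, h t * Complex.exp (-(2 * π * Complex.I * l * t / L)) = L * ∫ t, G t := by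
      have h2 := Measure.integral_comp_mul_left
        (fun t : ℝ => h t * Complex.exp (-(2 * π * Complex.I * l * t / L))) L
      rw [abs_of_pos (inv_pos.2 hL), Complex.real_smul] at h2
      have h3 : ∀ t : ℝ, h (L * t) *
          Complex.exp (-(2 * π * Complex.I * l * ((L * t : ℝ) : ℂ) / L)) = G t := by
        intro t
        simp only [G]
        congr 2
        push_cast
        field_simp
      simp only [h3] at h2
      rw [h2]
      push_cast
      field_simp
    rw [h1, integral_eq_intervalIntegral_sum hGi τ (J := J)
      (fun t ht j hj => by simp only [G, hJ t ht j hj, zero_mul]), fourierCoeffOn_eq_integral]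
    have h4 : (1 / (τ + 1 - τ) : ℝ) = 1 := by rw [add_sub_cancel_left, div_one]
    rw [h4, one_smul]
    congr 1
    refine intervalIntegral.integral_congr fun t _ => ?_
    simp only [smul_eq_mul, Finset.mul_sum, G]
    refine Finset.sum_congr rfl fun j _ => ?_
    rw [fourier_coe_apply, mul_comm]
    congr 1
    -- the phase is unchanged by the integer shift `j`
    have h5 : (-(2 * π * Complex.I * l * ((t + j : ℝ) : ℂ)) : ℂ)
        = 2 * π * Complex.I * ((-l : ℤ) : ℂ) * t / ((τ + 1 - τ : ℝ) : ℂ)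
          + ((-(l * j) : ℤ) : ℂ) * (2 * π * Complex.I) := by
      rw [add_sub_cancel_left]
      push_cast
      ring
    rw [h5, Complex.exp_add, Complex.exp_int_mul_two_pi_mul_I, mul_one]
  have h4 : (τ + 1 - τ : ℝ)⁻¹ = 1 := by rw [add_sub_cancel_left, inv_one]
  rw [h4, one_smul] at hP
  simpa only [hcoef, norm_mul, mul_pow, Complex.norm_real, Real.norm_of_nonneg hL.le] using hP

theorem inner_sechGabor_toLp {f : ℝ → ℂ} (hf : MemLp f 2 volume) (a b : ℝ) (k l : ℤ) :
    ⟪sechGabor a b (k, l), hf.toLp f⟫_ℂ = ∫ t, (sqrt (π / 2) : ℂ) *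
      ((f t * (sech (π * (t - a * k)) : ℂ)) *
        Complex.exp (-(2 * π * Complex.I * (b * l) * t))) := by
  rw [L2.inner_def]
  refine integral_congr_ae ?_
  filter_upwards [(memLp_timeFreqShift memLp_sechWindow (a * k) (b * l)).coeFn_toLp,
    hf.coeFn_toLp] with t h1 h2
  have h3 : (sechGabor a b (k, l) : ℝ → ℂ) t = timeFreqShift (a * k) (b * l) sechWindow t := h1
  rw [h2, h3, RCLike.inner_apply, timeFreqShift, sechWindow, map_mul, Complex.conj_ofReal,
    ← Complex.exp_conj]
  have h4 : starRingEnd ℂ (2 * π * Complex.I * ((b * l : ℝ) : ℂ) * t)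
      = -(2 * π * Complex.I * (b * l) * t) := by
    simp only [map_mul, Complex.conj_ofReal, Complex.conj_I, map_ofNat]
    push_cast
    ring
  rw [h4, sech]
  push_cast
  ring

/-- The density of the quadratic form of the frame operator in the fibre over `t`, for the samples
`z j = f (L (t + j))`, `L = n a`. -/
def fibreForm (n : ℕ) (a t : ℝ) (J : Finset ℤ) (z : ℤ → ℂ) : ℝ :=
  π / 2 * (n * a) * (sechSqSum (π * a) (n * t) * ∑ j ∈ J, ‖z j‖ ^ 2 + n * kapForm (π * a * n) J z)

/-- The frame sum decomposes into fibres: Parseval in the modulations, then the sum over the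
translations inside the integral. -/
theorem frameSum_sechGabor {f : ℝ → ℂ} (hc : Continuous f) (hs : HasCompactSupport f)
    (hf : MemLp f 2 volume) {n : ℕ} (hn : n ≠ 0) {a b : ℝ} (ha : 0 < a) (hb : b = (n * a)⁻¹)
    (τ : ℝ) {J : Finset ℤ} (hJ : ∀ t ∈ Set.Ioc τ (τ + 1), ∀ j ∉ J, f (n * a * (t + j)) = 0) :
    frameSum (sechGabor a b) (hf.toLp f) = ∫⁻ t in Set.Ioc τ (τ + 1),
      ENNReal.ofReal (n * a * fibreForm n a t J fun j => f (n * a * (t + j))) := by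
  have hn0 : (0 : ℝ) < n := by exact_mod_cast Nat.pos_of_ne_zero hn
  have hL : 0 < n * a := by positivity
  have hkc : ∀ k : ℤ, Continuous fun t => f t * (sech (π * (t - a * k)) : ℂ) := fun k =>
    hc.mul (Complex.continuous_ofReal.comp (continuous_sech.comp (by fun_prop)))
  have hki : ∀ k : ℤ, Integrable fun t => f t * (sech (π * (t - a * k)) : ℂ) := fun k =>
    (hkc k).integrable_of_hasCompactSupport hs.mul_right
  -- the contribution of one translate, by Parseval
  have hrow : ∀ k : ℤ, ∑' l : ℤ, ‖⟪sechGabor a b (k, l), hf.toLp f⟫_ℂ‖ₑ ^ 2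
      = ∫⁻ t in Set.Ioc τ (τ + 1), ENNReal.ofReal (π / 2 * (n * a) ^ 2 * ‖∑ j ∈ J,
        f (n * a * (t + j)) * (sech (π * (n * a * (t + j) - a * k)) : ℂ)‖ ^ 2) := by
    intro k
    have hP := (hasSum_sq_norm_integral_mul_exp (hkc k) (hki k) hL τ (J := J)
      (fun t ht j hj => by simp only [hJ t ht j hj, zero_mul])).mul_left (π / 2)
    have hterm : ∀ l : ℤ, ‖⟪sechGabor a b (k, l), hf.toLp f⟫_ℂ‖ₑ ^ 2 = ENNReal.ofReal (π / 2 *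
        ‖∫ t, (f t * (sech (π * (t - a * k)) : ℂ)) *
          Complex.exp (-(2 * π * Complex.I * l * t / (n * a : ℝ)))‖ ^ 2) := by
      intro l
      have hexp : ∀ t : ℝ, (-(2 * π * Complex.I * (b * l) * t) : ℂ)
          = -(2 * π * Complex.I * l * t / (n * a : ℝ)) := by
        intro t
        rw [hb]
        push_cast
        field_simp
      rw [inner_sechGabor_toLp, integral_const_mul, ← ofReal_norm,
        ← ENNReal.ofReal_pow (norm_nonneg _), norm_mul, mul_pow, Complex.norm_real,
        Real.norm_of_nonneg (sqrt_nonneg _), sq_sqrt (by positivity)]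
      simp only [hexp]
    simp only [hterm]
    rw [← ENNReal.ofReal_tsum_of_nonneg (fun l => by positivity) hP.summable, hP.tsum_eq,
      intervalIntegral.integral_of_le (by linarith), ← mul_assoc, ← integral_const_mul,
      ofReal_integral_eq_lintegral_ofReal]
    · have hcont : Continuous fun t => π / 2 * (n * a) ^ 2 * ‖∑ j ∈ J,
          f (n * a * (t + j)) * (sech (π * (n * a * (t + j) - a * k)) : ℂ)‖ ^ 2 := by
        refine continuous_const.mul ((continuous_finsetSum _ fun j _ => ?_).norm.pow 2)
        exact (hkc k).comp (by fun_prop)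
      exact hcont.integrableOn_Ioc
    · exact .of_forall fun t => by positivity
  rw [frameSum, ENNReal.tsum_prod']
  simp only [hrow]
  rw [← lintegral_tsum]
  · refine lintegral_congr fun t => ?_
    have hQ := ((Equiv.neg ℤ).hasSum_iff.2 (hasSum_sq_norm_sum_mul_sech (mul_pos pi_pos ha)
      (n * t) hn J fun j => f (n * a * (t + j)))).mul_left (π / 2 * (n * a) ^ 2)
    have harg : ∀ k j : ℤ, π * a * (((Equiv.neg ℤ) k : ℤ) + n * j + n * t)
        = π * (n * a * (t + j) - a * k) := by
      intro k j
      simp only [Equiv.neg_apply]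
      push_cast
      ring
    simp only [Function.comp_def, harg] at hQ
    rw [← ENNReal.ofReal_tsum_of_nonneg (fun k => by positivity) hQ.summable, hQ.tsum_eq, fibreForm]
    congr 1
    ring
  · intro k
    refine Measurable.aemeasurable (Continuous.measurable ?_)
    refine ENNReal.continuous_ofReal.comp
      (continuous_const.mul ((continuous_finsetSum _ fun j _ => ?_).norm.pow 2))
    exact (hkc k).comp (by fun_prop)

theorem sq_enorm_toLp {f : ℝ → ℂ} (hc : Continuous f)
    (hf : MemLp f 2 volume) {L : ℝ} (hL : 0 < L)
    (τ : ℝ) {J : Finset ℤ} (hJ : ∀ t ∈ Set.Ioc τ (τ + 1), ∀ j ∉ J, f (L * (t + j)) = 0) :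
    ‖hf.toLp f‖ₑ ^ 2 = ∫⁻ t in Set.Ioc τ (τ + 1),
      ENNReal.ofReal (L * ∑ j ∈ J, ‖f (L * (t + j))‖ ^ 2) := by
  have hi : Integrable fun t => ‖f t‖ ^ 2 := (memLp_two_iff_integrable_sq_norm hf.1).1 hf
  have h1 : ‖hf.toLp f‖ ^ 2 = ∫ t, ‖f t‖ ^ 2 := by
    have h2 := inner_self_eq_norm_sq_to_K (𝕜 := ℂ) (hf.toLp f)
    rw [L2.inner_def] at h2
    have h3 : ∫ t, ⟪hf.toLp f t, hf.toLp f t⟫_ℂ = ((∫ t, ‖f t‖ ^ 2 : ℝ) : ℂ) := by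
      rw [← integral_complex_ofReal]
      refine integral_congr_ae ?_
      filter_upwards [hf.coeFn_toLp] with t ht
      rw [ht, inner_self_eq_norm_sq_to_K]
      push_cast
      rfl
    rw [h3] at h2
    exact Complex.ofReal_injective ((Complex.ofReal_pow _ _).trans h2.symm)
  rw [← ofReal_norm, ← ENNReal.ofReal_pow (norm_nonneg _), h1,
    integral_eq_mul_intervalIntegral_sum hi hL τ (J := J)
      (fun t ht j hj => by simp [hJ t ht j hj]),
    intervalIntegral.integral_of_le (by linarith), ← integral_const_mul,
    ofReal_integral_eq_lintegral_ofReal]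
  · exact Continuous.integrableOn_Ioc (by fun_prop)
  · exact .of_forall fun t => by positivity

theorem frameSum_le_of_fibre {f : ℝ → ℂ} (hc : Continuous f) (hs : HasCompactSupport f)
    (hf : MemLp f 2 volume) {n : ℕ} (hn : n ≠ 0) {a b : ℝ} (ha : 0 < a) (hb : b = (n * a)⁻¹)
    (τ : ℝ) {J : Finset ℤ} (hJ : ∀ t ∈ Set.Ioc τ (τ + 1), ∀ j ∉ J, f (n * a * (t + j)) = 0)
    {B : ℝ} (hB : 0 ≤ B) (h : ∀ t ∈ Set.Ioc τ (τ + 1),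
      fibreForm n a t J (fun j => f (n * a * (t + j))) ≤ B * ∑ j ∈ J, ‖f (n * a * (t + j))‖ ^ 2) :
    frameSum (sechGabor a b) (hf.toLp f) ≤ ENNReal.ofReal B * ‖hf.toLp f‖ₑ ^ 2 := by
  have hn0 : (0 : ℝ) < n := by exact_mod_cast Nat.pos_of_ne_zero hn
  have hL : 0 < n * a := by positivity
  rw [frameSum_sechGabor hc hs hf hn ha hb τ hJ, sq_enorm_toLp hc hf hL τ hJ,
    ← lintegral_const_mul' _ _ ENNReal.ofReal_ne_top]
  refine setLIntegral_mono' measurableSet_Ioc fun t ht => ?_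
  rw [← ENNReal.ofReal_mul hB]
  refine ENNReal.ofReal_le_ofReal ?_
  calc n * a * _ ≤ n * a * (B * ∑ j ∈ J, ‖f (n * a * (t + j))‖ ^ 2) := by
        gcongr
        exact h t ht
    _ = _ := by ring

theorem le_frameSum_of_fibre {f : ℝ → ℂ} (hc : Continuous f) (hs : HasCompactSupport f)
    (hf : MemLp f 2 volume) {n : ℕ} (hn : n ≠ 0) {a b : ℝ} (ha : 0 < a) (hb : b = (n * a)⁻¹)
    (τ : ℝ) {J : Finset ℤ} (hJ : ∀ t ∈ Set.Ioc τ (τ + 1), ∀ j ∉ J, f (n * a * (t + j)) = 0)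
    {A : ℝ} (hA : 0 ≤ A) (h : ∀ t ∈ Set.Ioc τ (τ + 1),
      A * ∑ j ∈ J, ‖f (n * a * (t + j))‖ ^ 2 ≤ fibreForm n a t J (fun j => f (n * a * (t + j)))) :
    ENNReal.ofReal A * ‖hf.toLp f‖ₑ ^ 2 ≤ frameSum (sechGabor a b) (hf.toLp f) := by
  have hn0 : (0 : ℝ) < n := by exact_mod_cast Nat.pos_of_ne_zero hn
  have hL : 0 < n * a := by positivity
  rw [frameSum_sechGabor hc hs hf hn ha hb τ hJ, sq_enorm_toLp hc hf hL τ hJ,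
    ← lintegral_const_mul' _ _ ENNReal.ofReal_ne_top]
  refine setLIntegral_mono' measurableSet_Ioc fun t ht => ?_
  rw [← ENNReal.ofReal_mul hA]
  refine ENNReal.ofReal_le_ofReal ?_
  calc A * (n * a * ∑ j ∈ J, ‖f (n * a * (t + j))‖ ^ 2)
      = n * a * (A * ∑ j ∈ J, ‖f (n * a * (t + j))‖ ^ 2) := by ring
    _ ≤ _ := by
        gcongr
        exact h t ht

/-! ### The frame inequality on all of `L²` -/

theorem continuous_sq_enorm {X E : Type*} [TopologicalSpace X] [NormedAddCommGroup E] {u : X → E}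
    (hu : Continuous u) :
    Continuous fun x => ‖u x‖ₑ ^ 2 :=
  (ENNReal.continuous_pow 2).comp hu.enorm

section Dense

variable {H : Type*} [NormedAddCommGroup H] [InnerProductSpace ℂ H] {ι : Type*}

theorem frameSum_le_of_dense {e : ι → H} {D : Set H} (hD : Dense D) {B : ℝ}
    (h : ∀ f ∈ D, frameSum e f ≤ ENNReal.ofReal B * ‖f‖ₑ ^ 2) (f : H) :
    frameSum e f ≤ ENNReal.ofReal B * ‖f‖ₑ ^ 2 := by
  rw [frameSum, ENNReal.tsum_eq_iSup_sum]
  refine iSup_le fun s => ?_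
  have hcl : IsClosed {f : H | ∑ i ∈ s, ‖⟪e i, f⟫_ℂ‖ₑ ^ 2 ≤ ENNReal.ofReal B * ‖f‖ₑ ^ 2} := by
    refine isClosed_le (continuous_finsetSum _ fun i _ => ?_) ?_
    · exact (ENNReal.continuous_pow 2).comp (continuous_const.inner continuous_id).enorm
    · exact (ENNReal.continuous_const_mul ENNReal.ofReal_ne_top).comp
        (continuous_sq_enorm continuous_id)
  refine hcl.closure_subset_iff.2 (fun g hg => ?_) (hD f)
  exact (ENNReal.sum_le_tsum s).trans (h g hg)

theorem sq_enorm_add_le (x y : ℂ) {ε : ℝ} (hε : 0 < ε) :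
    ‖x + y‖ₑ ^ 2 ≤ ENNReal.ofReal (1 + ε) * ‖x‖ₑ ^ 2 + ENNReal.ofReal (1 + ε⁻¹) * ‖y‖ₑ ^ 2 := by
  simp only [← ofReal_norm, ← ENNReal.ofReal_pow (norm_nonneg _)]
  rw [← ENNReal.ofReal_mul (by positivity), ← ENNReal.ofReal_mul (by positivity),
    ← ENNReal.ofReal_add (by positivity) (by positivity)]
  refine ENNReal.ofReal_le_ofReal ?_
  have h1 : ‖x + y‖ ^ 2 ≤ (‖x‖ + ‖y‖) ^ 2 := by gcongr; exact norm_add_le x y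
  have h2 : 0 ≤ ε⁻¹ * (ε * ‖x‖ - ‖y‖) ^ 2 := by positivity
  have h3 : ε⁻¹ * (ε * ‖x‖ - ‖y‖) ^ 2 = ε * ‖x‖ ^ 2 - 2 * ‖x‖ * ‖y‖ + ε⁻¹ * ‖y‖ ^ 2 := by
    field_simp
    ring
  nlinarith

/-- A lower frame inequality extends from a dense set once an upper one is known. -/
theorem le_frameSum_of_dense {e : ι → H} {D : Set H} (hD : Dense D) {A B : ℝ}
    (hB : ∀ f, frameSum e f ≤ ENNReal.ofReal B * ‖f‖ₑ ^ 2)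
    (h : ∀ f ∈ D, ENNReal.ofReal A * ‖f‖ₑ ^ 2 ≤ frameSum e f) (f : H) :
    ENNReal.ofReal A * ‖f‖ₑ ^ 2 ≤ frameSum e f := by
  have hfin : frameSum e f ≠ ∞ :=
    ne_top_of_le_ne_top (ENNReal.mul_ne_top ENNReal.ofReal_ne_top (by finiteness)) (hB f)
  have key : ∀ ε : ℝ, 0 < ε →
      ENNReal.ofReal A * ‖f‖ₑ ^ 2 ≤ ENNReal.ofReal (1 + ε) * frameSum e f := by
    intro ε hε
    have hcl : IsClosed {g : H | ENNReal.ofReal A * ‖g‖ₑ ^ 2 ≤ ENNReal.ofReal (1 + ε) * frameSum e f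
        + ENNReal.ofReal (1 + ε⁻¹) * (ENNReal.ofReal B * ‖g - f‖ₑ ^ 2)} := by
      refine isClosed_le ?_ (continuous_const.add ?_)
      · exact (ENNReal.continuous_const_mul ENNReal.ofReal_ne_top).comp
          (continuous_sq_enorm continuous_id)
      · exact (ENNReal.continuous_const_mul ENNReal.ofReal_ne_top).comp
          ((ENNReal.continuous_const_mul ENNReal.ofReal_ne_top).comp
            (continuous_sq_enorm (continuous_id.sub continuous_const)))
    have hf := hcl.closure_subset_iff.2 (fun g hg => ?_) (hD f)
    · simpa using hf
    · refine (h g hg).trans ?_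
      calc frameSum e g ≤ ∑' i, (ENNReal.ofReal (1 + ε) * ‖⟪e i, f⟫_ℂ‖ₑ ^ 2
            + ENNReal.ofReal (1 + ε⁻¹) * ‖⟪e i, g - f⟫_ℂ‖ₑ ^ 2) := by
            refine ENNReal.tsum_le_tsum fun i => ?_
            have := sq_enorm_add_le ⟪e i, f⟫_ℂ ⟪e i, g - f⟫_ℂ hε
            rwa [← inner_add_right, add_sub_cancel] at this
        _ = ENNReal.ofReal (1 + ε) * frameSum e f
            + ENNReal.ofReal (1 + ε⁻¹) * frameSum e (g - f) := by
            rw [ENNReal.tsum_add, ENNReal.tsum_mul_left, ENNReal.tsum_mul_left]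
            rfl
        _ ≤ _ := by
            gcongr
            exact hB _
  have hlim : Tendsto (fun ε : ℝ => ENNReal.ofReal (1 + ε) * frameSum e f) (𝓝[>] 0)
      (𝓝 (ENNReal.ofReal (1 + 0) * frameSum e f)) := by
    refine ENNReal.Tendsto.mul_const ?_ (Or.inr hfin)
    refine Tendsto.mono_left (Continuous.tendsto ?_ 0) nhdsWithin_le_nhds
    exact ENNReal.continuous_ofReal.comp (by fun_prop)
  rw [add_zero, ENNReal.ofReal_one, one_mul] at hlim
  exact ge_of_tendsto hlim (by filter_upwards [self_mem_nhdsWithin] with ε hε using key ε hε)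

theorem ofReal_le_upperFrameBound {e : ι → H} {V : ℝ}
    (h : ∀ η, 0 < η → 0 ≤ V - η → ∃ f ≠ 0, ENNReal.ofReal (V - η) * ‖f‖ₑ ^ 2 ≤ frameSum e f) :
    ENNReal.ofReal V ≤ upperFrameBound e := by
  refine le_sInf fun B hB => ?_
  rcases eq_or_ne B ∞ with rfl | hB'
  · exact le_top
  rw [ENNReal.ofReal_le_iff_le_toReal hB']
  by_contra! hlt
  obtain ⟨f, hf, h1⟩ := h ((V - B.toReal) / 2) (by linarith)
    (by linarith [ENNReal.toReal_nonneg (a := B)])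
  have h2 := h1.trans (hB f)
  rw [ENNReal.mul_le_mul_iff_left (by simpa using hf) (by finiteness),
    ENNReal.ofReal_le_iff_le_toReal hB'] at h2
  linarith

theorem lowerFrameBound_le_ofReal {e : ι → H} {V : ℝ} (hV : 0 ≤ V)
    (h : ∀ η, 0 < η → ∃ f ≠ 0, frameSum e f ≤ ENNReal.ofReal (V + η) * ‖f‖ₑ ^ 2) :
    lowerFrameBound e ≤ ENNReal.ofReal V := by
  refine sSup_le fun A hA => ?_
  have key : ∀ η, 0 < η → A ≤ ENNReal.ofReal (V + η) := by
    intro η hη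
    obtain ⟨f, hf, h1⟩ := h η hη
    have h2 := (hA f).trans h1
    rwa [ENNReal.mul_le_mul_iff_left (by simpa using hf) (by finiteness)] at h2
  refine ENNReal.le_of_forall_pos_le_add fun η hη _ => ?_
  refine (key η (NNReal.coe_pos.2 hη)).trans ?_
  rw [ENNReal.ofReal_add hV η.coe_nonneg, ENNReal.ofReal_coe_nnreal]

end Dense

theorem dense_range_toLp_hasCompactSupport :
    Dense {F : Lp ℂ 2 (volume : Measure ℝ) | ∃ (f : ℝ → ℂ) (hf : MemLp f 2 volume),
      Continuous f ∧ HasCompactSupport f ∧ F = hf.toLp f} := by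
  intro F
  rw [Metric.mem_closure_iff]
  intro ε hε
  obtain ⟨f, hs, hle, hc, hf⟩ := (Lp.memLp F).exists_hasCompactSupport_eLpNorm_sub_le
    (by norm_num) (ε := ENNReal.ofReal (ε / 2)) (by simpa using hε)
  refine ⟨hf.toLp f, ⟨f, hf, hc, hs, rfl⟩, ?_⟩
  have h1 : F - hf.toLp f = ((Lp.memLp F).sub hf).toLp _ := by
    rw [MemLp.toLp_sub (Lp.memLp F) hf, Lp.toLp_coeFn F (Lp.memLp F)]
  rw [dist_eq_norm, h1, Lp.norm_toLp]
  have h2 := ENNReal.toReal_mono ENNReal.ofReal_ne_top hle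
  rw [ENNReal.toReal_ofReal (by positivity)] at h2
  exact h2.trans_lt (by linarith)

theorem exists_finset_forall_notMem_eq_zero {f : ℝ → ℂ} (hs : HasCompactSupport f) {L : ℝ}
    (hL : 0 < L) (τ : ℝ) : ∃ J : Finset ℤ, ∀ t ∈ Set.Ioc τ (τ + 1), ∀ j ∉ J, f (L * (t + j)) = 0 := by
  obtain ⟨R, hR⟩ := hs.isCompact.isBounded.subset_closedBall 0
  refine ⟨Finset.Icc (-⌈R / L + |τ| + 1⌉) ⌈R / L + |τ| + 1⌉, fun t ht j hj => ?_⟩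
  by_contra hne
  apply hj
  have h1 := hR (subset_tsupport _ hne)
  rw [mem_closedBall_zero_iff, norm_eq_abs, abs_mul, abs_of_pos hL, ← le_div_iff₀' hL] at h1
  have h2 := abs_le.1 h1
  have h3 := neg_abs_le τ
  have h4 := le_abs_self τ
  have h5 := Int.le_ceil (R / L + |τ| + 1)
  rw [Finset.mem_Icc]
  constructor
  · have : (-(⌈R / L + |τ| + 1⌉ : ℝ)) ≤ j := by linarith [ht.1, ht.2, h2.1]
    exact_mod_cast this
  · have : (j : ℝ) ≤ ⌈R / L + |τ| + 1⌉ := by linarith [ht.1, ht.2, h2.2]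
    exact_mod_cast this

/-- The value `n (S(a) - S(na))` of the sharp lower frame bound. -/
def lowerValue (n : ℕ) (a : ℝ) : ℝ := n * (halfSum a - halfSum (n * a))

/-- The value `n (H(1/a) + H(na) - 1)` of the sharp upper frame bound. -/
def upperValue (n : ℕ) (a : ℝ) : ℝ := n * (ambiguitySum a⁻¹ + ambiguitySum (n * a) - 1)

theorem lowerValue_eq (n : ℕ) (a : ℝ) : lowerValue n a =
    π / 2 * (n * a) * (sechSqSum (π * a) (1 / 2) - n * sechSqSum (π * a * n) (1 / 2)) := by
  rw [lowerValue, halfSum, halfSum, show π * (n * a) = π * a * n by ring]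
  ring

theorem upperValue_eq {n : ℕ} {a : ℝ} (ha : 0 < a) : upperValue n a =
    π / 2 * (n * a) * (sechSqSum (π * a) 0 + n * ∑' m, kap (π * a * n) m) := by
  rw [upperValue, ambiguitySum_eq (inv_pos.2 ha), ambiguitySum,
    show π * (n * a) = π * a * n by ring, div_inv_eq_mul]
  field_simp
  ring

theorem fibreForm_le {n : ℕ} (hn : n ≠ 0) {a : ℝ} (ha : 0 < a) (t : ℝ) (J : Finset ℤ) (z : ℤ → ℂ) :
    fibreForm n a t J z ≤ upperValue n a * ∑ j ∈ J, ‖z j‖ ^ 2 := by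
  have hn0 : (0 : ℝ) < n := by exact_mod_cast Nat.pos_of_ne_zero hn
  have hπa := mul_pos pi_pos ha
  rw [fibreForm, upperValue_eq ha, mul_assoc (π / 2 * (n * a)), add_mul, mul_assoc (n : ℝ)]
  gcongr
  · exact sechSqSum_le hπa _
  · exact kapForm_le (mul_pos hπa hn0) J z

theorem le_fibreForm {n : ℕ} (hn : n ≠ 0) {a : ℝ} (ha : 0 < a) (t : ℝ) (J : Finset ℤ) (z : ℤ → ℂ) :
    lowerValue n a * ∑ j ∈ J, ‖z j‖ ^ 2 ≤ fibreForm n a t J z := by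
  have hn0 : (0 : ℝ) < n := by exact_mod_cast Nat.pos_of_ne_zero hn
  have hπa := mul_pos pi_pos ha
  rw [fibreForm, lowerValue_eq, mul_assoc (π / 2 * (n * a)), sub_mul, mul_assoc (n : ℝ),
    sub_eq_add_neg, ← mul_neg]
  gcongr
  · exact le_sechSqSum hπa _
  · exact neg_le_kapForm (mul_pos hπa hn0) J z

theorem lowerValue_pos {n : ℕ} (hn : 2 ≤ n) {a : ℝ} (ha : 0 < a) : 0 < lowerValue n a := by
  have hn0 : (2 : ℝ) ≤ n := by exact_mod_cast hn
  refine mul_pos (by linarith) (sub_pos.2 (halfSum_strictAntiOn ha ?_ ?_))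
  · exact mul_pos (by linarith) ha
  · nlinarith

theorem upperValue_pos {n : ℕ} (hn : n ≠ 0) {a : ℝ} (ha : 0 < a) : 0 < upperValue n a := by
  have hn0 : (0 : ℝ) < n := by exact_mod_cast Nat.pos_of_ne_zero hn
  have hπa := mul_pos pi_pos ha
  rw [upperValue_eq ha]
  have h1 := sechSqSum_pos hπa 0
  have h2 : 0 ≤ ∑' m, kap (π * a * n) m := tsum_nonneg fun m => kap_nonneg (mul_pos hπa hn0) m
  positivity

theorem frameSum_sechGabor_le {n : ℕ} (hn : n ≠ 0) {a b : ℝ} (ha : 0 < a) (hb : b = (n * a)⁻¹)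
    (F : Lp ℂ 2 (volume : Measure ℝ)) :
    frameSum (sechGabor a b) F ≤ ENNReal.ofReal (upperValue n a) * ‖F‖ₑ ^ 2 := by
  have hn0 : (0 : ℝ) < n := by exact_mod_cast Nat.pos_of_ne_zero hn
  refine frameSum_le_of_dense dense_range_toLp_hasCompactSupport ?_ F
  rintro _ ⟨f, hf, hc, hs, rfl⟩
  obtain ⟨J, hJ⟩ := exists_finset_forall_notMem_eq_zero hs (mul_pos hn0 ha) 0
  exact frameSum_le_of_fibre hc hs hf hn ha hb 0 hJ (upperValue_pos hn ha).le
    fun t _ => fibreForm_le hn ha t J _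

theorem le_frameSum_sechGabor {n : ℕ} (hn : 2 ≤ n) {a b : ℝ} (ha : 0 < a) (hb : b = (n * a)⁻¹)
    (F : Lp ℂ 2 (volume : Measure ℝ)) :
    ENNReal.ofReal (lowerValue n a) * ‖F‖ₑ ^ 2 ≤ frameSum (sechGabor a b) F := by
  have hn' : n ≠ 0 := by omega
  have hn0 : (0 : ℝ) < n := by exact_mod_cast Nat.pos_of_ne_zero hn'
  refine le_frameSum_of_dense dense_range_toLp_hasCompactSupport
    (frameSum_sechGabor_le hn' ha hb) ?_ F
  rintro _ ⟨f, hf, hc, hs, rfl⟩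
  obtain ⟨J, hJ⟩ := exists_finset_forall_notMem_eq_zero hs (mul_pos hn0 ha) 0
  exact le_frameSum_of_fibre hc hs hf hn' ha hb 0 hJ (lowerValue_pos hn ha).le
    fun t _ => le_fibreForm hn' ha t J _

/-- The Poisson dual converges uniformly. -/
theorem continuous_sechSqSum {c : ℝ} (hc : 0 < c) : Continuous (sechSqSum c) := by
  obtain ⟨s, hs, rfl⟩ : ∃ s : ℝ, 0 < s ∧ c = π / s :=
    ⟨π / c, div_pos pi_pos hc, by field_simp⟩
  have h1 : Continuous fun x : ℝ => ∑' d : ℤ,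
      Complex.exp (2 * π * Complex.I * x) ^ d * (kap (π * s) d : ℂ) := by
    refine continuous_tsum (u := kap (π * s)) (fun d => ?_) (summable_kap (mul_pos pi_pos hs))
      fun d x => ?_
    · simp only [← Complex.exp_int_mul]
      fun_prop
    · rw [norm_mul, norm_zpow, norm_exp_two_pi_mul_I_mul, one_zpow, one_mul, Complex.norm_real,
        Real.norm_of_nonneg (kap_nonneg (mul_pos pi_pos hs) _)]
  have h2 : ∀ x, sechSqSum (π / s) x = 2 * s / π * (1 + (π * s / 2 : ℂ) * ∑' d : ℤ,
      Complex.exp (2 * π * Complex.I * x) ^ d * (kap (π * s) d : ℂ)).re := by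
    intro x
    rw [← poisson_sech_sq hs x, Complex.ofReal_re]
    have := pi_pos
    field_simp
  rw [show sechSqSum (π / s) = _ from funext h2]
  exact continuous_const.mul (Complex.continuous_re.comp
    (continuous_const.add (continuous_const.mul h1)))

/-! ### Sharpness and the values of the frame bounds -/

/-- The tent of height `1` and half-width `δ` at `t₀`. -/
def tent (t₀ δ t : ℝ) : ℝ := max 0 (1 - |t - t₀| / δ)

theorem tent_self (t₀ δ : ℝ) : tent t₀ δ t₀ = 1 := by simp [tent]

theorem tent_eq_zero {t₀ δ t : ℝ} (hδ : 0 < δ) (h : δ ≤ |t - t₀|) : tent t₀ δ t = 0 :=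
  max_eq_left (sub_nonpos.2 ((one_le_div hδ).2 h))

theorem continuous_tent (t₀ δ : ℝ) : Continuous (tent t₀ δ) := by
  unfold tent
  fun_prop

/-- The function with samples `f (L (t + j)) = εʲ φ(t)` for `0 ≤ j < N` and `0` for other `j`, where `φ`
is the tent at `t₀` and `t` ranges over the period centred at `t₀`. -/
def tentTrain (L ε t₀ δ : ℝ) (N : ℕ) (u : ℝ) : ℂ :=
  ∑ m ∈ Finset.Ico (0 : ℤ) N, ((ε ^ m * tent t₀ δ (u / L - m) : ℝ) : ℂ)

theorem continuous_tentTrain (L ε t₀ δ : ℝ) (N : ℕ) : Continuous (tentTrain L ε t₀ δ N) := by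
  refine continuous_finsetSum _ fun m _ => Complex.continuous_ofReal.comp (continuous_const.mul ?_)
  exact (continuous_tent t₀ δ).comp (by fun_prop)

theorem hasCompactSupport_tentTrain {L δ : ℝ} (hL : 0 < L) (ε t₀ : ℝ) (hδ : 0 < δ) (hδ' : δ ≤ 1 / 2)
    (N : ℕ) : HasCompactSupport (tentTrain L ε t₀ δ N) := by
  refine HasCompactSupport.intro (isCompact_closedBall (0 : ℝ) (L * (|t₀| + N + 1))) fun u hu => ?_
  refine Finset.sum_eq_zero fun m hm => ?_
  rw [Finset.mem_Ico] at hm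
  have hm0 : (0 : ℝ) ≤ m := by exact_mod_cast hm.1
  have hm1 : (m : ℝ) ≤ N := by exact_mod_cast hm.2.le
  rw [mem_closedBall_zero_iff, norm_eq_abs, not_le, ← lt_div_iff₀' hL] at hu
  rw [tent_eq_zero hδ, mul_zero, Complex.ofReal_zero]
  have h1 : |u| / L = |u / L| := by rw [abs_div, abs_of_pos hL]
  have h2 : |u / L| ≤ |u / L - m - t₀| + |m + t₀| := by
    calc |u / L| = |(u / L - m - t₀) + (m + t₀)| := by ring_nf
      _ ≤ _ := abs_add_le _ _
  have h3 : |m + t₀| ≤ m + |t₀| := (abs_add_le _ _).trans_eq (by rw [abs_of_nonneg hm0])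
  linarith

theorem tentTrain_apply {L δ : ℝ} (hL : 0 < L) (ε t₀ : ℝ) (hδ : 0 < δ) (hδ' : δ ≤ 1 / 2)
    (N : ℕ) {t : ℝ} (ht : t ∈ Set.Ioc (t₀ - 1 / 2) (t₀ - 1 / 2 + 1)) (j : ℤ) :
    tentTrain L ε t₀ δ N (L * (t + j)) =
      if j ∈ Finset.Ico (0 : ℤ) N then ((ε ^ j * tent t₀ δ t : ℝ) : ℂ) else 0 := by
  have h0 : ∀ m : ℤ, L * (t + j) / L - m = t + (j - m : ℤ) := by
    intro m
    push_cast
    field_simp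
    ring
  have h1 : ∀ m : ℤ, m ≠ j → tent t₀ δ (t + (j - m : ℤ)) = 0 := by
    intro m hm
    refine tent_eq_zero hδ (hδ'.trans ?_)
    rcases lt_or_gt_of_ne hm with h | h
    · have : (1 : ℝ) ≤ ((j - m : ℤ) : ℝ) := by exact_mod_cast (by omega : (1 : ℤ) ≤ j - m)
      exact le_trans (by linarith [ht.1]) (le_abs_self _)
    · have : ((j - m : ℤ) : ℝ) ≤ -1 := by exact_mod_cast (by omega : (j - m : ℤ) ≤ -1)
      exact le_trans (by linarith [ht.2]) (neg_le_abs _)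
  simp only [tentTrain, h0]
  split_ifs with hj
  · rw [Finset.sum_eq_single_of_mem j hj fun m _ hm => by
      rw [h1 m hm, mul_zero, Complex.ofReal_zero]]
    simp
  · refine Finset.sum_eq_zero fun m hm => ?_
    rw [h1 m (fun h => hj (h ▸ hm)), mul_zero, Complex.ofReal_zero]

theorem fibreForm_alternating (n : ℕ) (a t φ : ℝ) {ε : ℝ} (hε : ε = 1 ∨ ε = -1) (N : ℕ) :
    fibreForm n a t (Finset.Ico (0 : ℤ) N) (fun j => ((ε ^ j * φ : ℝ) : ℂ))
      = π / 2 * (n * a) * φ ^ 2 * (sechSqSum (π * a) (n * t) * N + n *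
        ∑ i ∈ Finset.Ico (0 : ℤ) N, ∑ j ∈ Finset.Ico (0 : ℤ) N,
          ε ^ (i - j) * kap (π * a * n) (i - j)) := by
  have hε0 : ε ≠ 0 := by rcases hε with rfl | rfl <;> norm_num
  have hεsq : ∀ j : ℤ, ε ^ j * ε ^ j = 1 := by
    intro j
    rw [← mul_zpow]
    rcases hε with rfl | rfl <;> norm_num
  have h1 : ∑ j ∈ Finset.Ico (0 : ℤ) N, ‖((ε ^ j * φ : ℝ) : ℂ)‖ ^ 2 = N * φ ^ 2 := by
    have : ∀ j : ℤ, ‖((ε ^ j * φ : ℝ) : ℂ)‖ ^ 2 = φ ^ 2 := by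
      intro j
      rw [Complex.norm_real, norm_eq_abs, sq_abs, mul_pow, sq (ε ^ j), hεsq, one_mul]
    rw [Finset.sum_congr rfl fun j _ => this j]
    simp
  have h2 : kapForm (π * a * n) (Finset.Ico (0 : ℤ) N) (fun j => ((ε ^ j * φ : ℝ) : ℂ))
      = φ ^ 2 * ∑ i ∈ Finset.Ico (0 : ℤ) N, ∑ j ∈ Finset.Ico (0 : ℤ) N,
          ε ^ (i - j) * kap (π * a * n) (i - j) := by
    simp only [kapForm, Finset.mul_sum]
    refine Finset.sum_congr rfl fun i _ => Finset.sum_congr rfl fun j _ => ?_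
    rw [Complex.conj_ofReal, ← Complex.ofReal_mul, Complex.ofReal_re, zpow_sub₀ hε0,
      div_eq_mul_inv, ← eq_inv_of_mul_eq_one_left (hεsq j)]
    ring
  rw [fibreForm, h1, h2]
  ring

/-- The modulated tent trains approximately diagonalize the frame operator: they concentrate in
the fibre over `t₀` and at the frequency of the character `j ↦ εʲ`. -/
theorem exists_almost_extremal {n : ℕ} (hn : n ≠ 0) {a b : ℝ} (ha : 0 < a) (hb : b = (n * a)⁻¹)
    {ε : ℝ} (hε : ε = 1 ∨ ε = -1) (t₀ : ℝ) {V : ℝ} (hV : V = π / 2 * (n * a) *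
      (sechSqSum (π * a) (n * t₀) + n * ∑' m : ℤ, ε ^ m * kap (π * a * n) m)) {η : ℝ} (hη : 0 < η) :
    ∃ F : Lp ℂ 2 (volume : Measure ℝ), F ≠ 0 ∧
      (0 ≤ V - η → ENNReal.ofReal (V - η) * ‖F‖ₑ ^ 2 ≤ frameSum (sechGabor a b) F) ∧
      (0 ≤ V + η → frameSum (sechGabor a b) F ≤ ENNReal.ofReal (V + η) * ‖F‖ₑ ^ 2) := by
  have hn0 : (0 : ℝ) < n := by exact_mod_cast Nat.pos_of_ne_zero hn
  have hL : 0 < n * a := by positivity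
  have hπa := mul_pos pi_pos ha
  have hK : 0 < π / 2 * (n * a) := by positivity
  -- choose the number of teeth by the convergence of Toeplitz means, their width by continuity
  have hsum : Summable fun m : ℤ => ε ^ m * kap (π * a * n) m := by
    refine Summable.of_norm_bounded (summable_kap (mul_pos hπa hn0)) fun m => ?_
    have h1 : ‖ε‖ = 1 := by rcases hε with rfl | rfl <;> norm_num
    rw [norm_mul, norm_zpow, h1, one_zpow, one_mul,
      Real.norm_of_nonneg (kap_nonneg (mul_pos hπa hn0) _)]
  set η' := η / (π / 2 * (n * a)) / 2 with hη'
  have hη'0 : 0 < η' := by positivity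
  obtain ⟨N, hN, hN0⟩ := ((Metric.tendsto_nhds.1
    ((tendsto_toeplitz_mean hsum).const_mul (n : ℝ)) η' hη'0).and (eventually_gt_atTop 0)).exists
  have hN0' : (0 : ℝ) < N := Nat.cast_pos.2 hN0
  have hcont : Continuous fun t => sechSqSum (π * a) (n * t) :=
    (continuous_sechSqSum hπa).comp (by fun_prop)
  obtain ⟨δ₀, hδ₀, hδ₀'⟩ := Metric.continuous_iff.1 hcont t₀ η' hη'0
  set δ := min δ₀ (1 / 2) with hδdef
  have hδ : 0 < δ := lt_min hδ₀ (by norm_num)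
  have hδ' : δ ≤ 1 / 2 := min_le_right _ _
  set f := tentTrain (n * a) ε t₀ δ N with hfdef
  have hc : Continuous f := continuous_tentTrain _ _ _ _ _
  have hs : HasCompactSupport f := hasCompactSupport_tentTrain hL ε t₀ hδ hδ' N
  have hf : MemLp f 2 volume := hc.memLp_of_hasCompactSupport hs
  have hval : ∀ t ∈ Set.Ioc (t₀ - 1 / 2) (t₀ - 1 / 2 + 1), ∀ j : ℤ, f (n * a * (t + j)) =
      if j ∈ Finset.Ico (0 : ℤ) N then ((ε ^ j * tent t₀ δ t : ℝ) : ℂ) else 0 := fun t ht j =>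
    tentTrain_apply hL ε t₀ hδ hδ' N ht j
  have hJ : ∀ t ∈ Set.Ioc (t₀ - 1 / 2) (t₀ - 1 / 2 + 1), ∀ j ∉ Finset.Ico (0 : ℤ) N,
      f (n * a * (t + j)) = 0 := fun t ht j hj => by rw [hval t ht, if_neg hj]
  have hfib : ∀ t ∈ Set.Ioc (t₀ - 1 / 2) (t₀ - 1 / 2 + 1),
      |fibreForm n a t (Finset.Ico (0 : ℤ) N) (fun j => f (n * a * (t + j)))
        - V * ∑ j ∈ Finset.Ico (0 : ℤ) N, ‖f (n * a * (t + j))‖ ^ 2|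
      ≤ η * ∑ j ∈ Finset.Ico (0 : ℤ) N, ‖f (n * a * (t + j))‖ ^ 2 := by
    intro t ht
    have h1 : ∑ j ∈ Finset.Ico (0 : ℤ) N, ‖f (n * a * (t + j))‖ ^ 2 = N * tent t₀ δ t ^ 2 := by
      have : ∀ j ∈ Finset.Ico (0 : ℤ) N, ‖f (n * a * (t + j))‖ ^ 2 = tent t₀ δ t ^ 2 := by
        intro j hj
        have hεj : |ε ^ j| = 1 := by
          rw [abs_zpow]
          rcases hε with rfl | rfl <;> norm_num
        rw [hval t ht, if_pos hj, Complex.norm_real, norm_eq_abs, abs_mul, hεj, one_mul, sq_abs]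
      rw [Finset.sum_congr rfl this]
      simp
    have h2 : fibreForm n a t (Finset.Ico (0 : ℤ) N) (fun j => f (n * a * (t + j)))
        = fibreForm n a t (Finset.Ico (0 : ℤ) N) (fun j => ((ε ^ j * tent t₀ δ t : ℝ) : ℂ)) := by
      have h3 : ∀ j ∈ Finset.Ico (0 : ℤ) N,
          f (n * a * (t + j)) = ((ε ^ j * tent t₀ δ t : ℝ) : ℂ) := fun j hj => by
        rw [hval t ht, if_pos hj]
      simp only [fibreForm, kapForm]
      congr 2
      · rw [Finset.sum_congr rfl fun j hj => by rw [h3 j hj]]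
      · congr 1
        exact Finset.sum_congr rfl fun i hi => Finset.sum_congr rfl fun j hj => by
          rw [h3 i hi, h3 j hj]
    rw [h2, fibreForm_alternating n a t _ hε, h1, hV]
    rcases le_or_gt δ |t - t₀| with hfar | hnear
    · rw [tent_eq_zero hδ hfar]
      simp
    · have hG := hδ₀' t (by rw [dist_eq]; exact hnear.trans_le (min_le_left _ _))
      rw [dist_eq] at hG hN
      set T := ∑ i ∈ Finset.Ico (0 : ℤ) N, ∑ j ∈ Finset.Ico (0 : ℤ) N,
          ε ^ (i - j) * kap (π * a * n) (i - j)
      set X := sechSqSum (π * a) (n * t) - sechSqSum (π * a) (n * t₀) with hX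
      set Y := n * (T / N) - n * ∑' m : ℤ, ε ^ m * kap (π * a * n) m with hY
      have h3 : π / 2 * (n * a) * tent t₀ δ t ^ 2 * (sechSqSum (π * a) (n * t) * N + n * T)
          - π / 2 * (n * a) * (sechSqSum (π * a) (n * t₀)
            + n * ∑' m : ℤ, ε ^ m * kap (π * a * n) m) * (N * tent t₀ δ t ^ 2)
          = (π / 2 * (n * a) * (X + Y)) * (N * tent t₀ δ t ^ 2) := by
        rw [hX, hY]
        field_simp
        ring
      rw [h3, abs_mul, abs_of_nonneg (by positivity : 0 ≤ N * tent t₀ δ t ^ 2)]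
      gcongr
      rw [abs_mul, abs_of_pos hK]
      have h4 : |X + Y| ≤ η' + η' := (abs_add_le X Y).trans (add_le_add hG.le hN.le)
      calc π / 2 * (n * a) * |X + Y| ≤ π / 2 * (n * a) * (η' + η') := by gcongr
        _ = η := by
          rw [hη', add_halves]
          field_simp
  refine ⟨hf.toLp f, ?_, fun h0 => ?_, fun h0 => ?_⟩
  · intro h
    have h1 : f =ᵐ[volume] (fun _ => 0) := 
      hf.coeFn_toLp.symm.trans ((Lp.eq_zero_iff_ae_eq_zero).1 h)
    have h2 := congrFun ((hc.ae_eq_iff_eq volume continuous_const).1 h1) (n * a * (t₀ + (0 : ℤ)))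
    rw [hval t₀ ⟨by linarith, by linarith⟩ 0, if_pos (by simpa using hN0), tent_self] at h2
    simp at h2
  · refine le_frameSum_of_fibre hc hs hf hn ha hb _ hJ h0 fun t ht => ?_
    linarith [(abs_le.1 (hfib t ht)).1]
  · refine frameSum_le_of_fibre hc hs hf hn ha hb _ hJ h0 fun t ht => ?_
    linarith [(abs_le.1 (hfib t ht)).2]

theorem upperFrameBound_sechGabor {n : ℕ} (hn : n ≠ 0) {a b : ℝ} (ha : 0 < a)
    (hb : b = (n * a)⁻¹) : upperFrameBound (sechGabor a b) = ENNReal.ofReal (upperValue n a) := by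
  refine le_antisymm (sInf_le fun F => frameSum_sechGabor_le hn ha hb F)
    (ofReal_le_upperFrameBound fun η hη h0 => ?_)
  obtain ⟨F, hF, h1, -⟩ := exists_almost_extremal hn ha hb (Or.inl rfl) 0 (V := upperValue n a)
    (by rw [upperValue_eq ha]; simp) hη
  exact ⟨F, hF, h1 h0⟩

theorem lowerFrameBound_sechGabor {n : ℕ} (hn : 2 ≤ n) {a b : ℝ} (ha : 0 < a)
    (hb : b = (n * a)⁻¹) : lowerFrameBound (sechGabor a b) = ENNReal.ofReal (lowerValue n a) := by
  have hn' : n ≠ 0 := by omega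
  have hn0 : (0 : ℝ) < n := by exact_mod_cast Nat.pos_of_ne_zero hn'
  have hV := lowerValue_pos hn ha
  refine le_antisymm (lowerFrameBound_le_ofReal hV.le fun η hη => ?_)
    (le_sSup fun F => le_frameSum_sechGabor hn ha hb F)
  -- at `t₀ = 1 / (2n)` the diagonal part `G (πa, n t)` is minimal
  obtain ⟨F, hF, -, h1⟩ := exists_almost_extremal hn' ha hb (Or.inr rfl) (1 / (2 * n))
    (V := lowerValue n a) (by
      rw [lowerValue_eq, tsum_neg_one_zpow_mul_kap (mul_pos (mul_pos pi_pos ha) hn0),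
        show (n : ℝ) * (1 / (2 * n)) = 1 / 2 by field_simp]
      ring) hη
  exact ⟨F, hF, h1 (by linarith)⟩

theorem lowerValue_lt {n : ℕ} (hn : 2 ≤ n) {a : ℝ} (ha : 0 < a) (hne : a ≠ 1 / sqrt n) :
    lowerValue n a < lowerValue n (1 / sqrt n) := by
  have hn0 : (2 : ℝ) ≤ n := by exact_mod_cast hn
  have hν : 0 < sqrt n := sqrt_pos.2 (by linarith)
  have hsq : sqrt n ^ 2 = n := sq_sqrt (by linarith)
  have h := two_mul_halfSum_lt hν (by rw [hsq]; exact hn0) (inv_pos.2 ha)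
    (fun h => hne (by rw [one_div, ← h, inv_inv]))
  have h1 := halfSum_inv ha
  have h2 := halfSum_inv hν
  have h3 : (n : ℝ) * (1 / sqrt n) = sqrt n := by
    rw [mul_one_div, div_eq_iff hν.ne', ← sq, hsq]
  rw [lowerValue, lowerValue, h3, one_div, h2]
  rw [hsq, div_inv_eq_mul, h1] at h
  have hn1 : (0 : ℝ) < n := by linarith
  exact mul_lt_mul_of_pos_left (by linarith) hn1

theorem upperValue_lt {n : ℕ} (hn : n ≠ 0) {a : ℝ} (ha : 0 < a) (hne : a ≠ 1 / sqrt n) :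
    upperValue n (1 / sqrt n) < upperValue n a := by
  have hn0 : (0 : ℝ) < n := by exact_mod_cast Nat.pos_of_ne_zero hn
  have hν : 0 < sqrt n := sqrt_pos.2 hn0
  have hsq : sqrt n ^ 2 = n := sq_sqrt hn0.le
  have h := two_mul_ambiguitySum_lt hν (inv_pos.2 ha)
    (fun h => hne (by rw [one_div, ← h, inv_inv]))
  have h3 : (n : ℝ) * (1 / sqrt n) = sqrt n := by
    rw [mul_one_div, div_eq_iff hν.ne', ← sq, hsq]
  rw [upperValue, upperValue, h3, one_div, inv_inv]
  rw [hsq, div_inv_eq_mul] at h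
  exact mul_lt_mul_of_pos_left (by linarith) hn0

end GaborFrame

end

open GaborFrame in
theorem theorem2p1 (n : ℕ) (hn : 2 ≤ n) (a b : ℝ) (ha : 0 < a) (hb : 0 < b)
    (hab : (a * b)⁻¹ = (n : ℝ)) :
    IsFrame (sechGabor a b) ∧
    (lowerFrameBound (sechGabor a b) ≤
        lowerFrameBound (sechGabor (1 / Real.sqrt n) (1 / Real.sqrt n)) ∧
      (lowerFrameBound (sechGabor a b) =
          lowerFrameBound (sechGabor (1 / Real.sqrt n) (1 / Real.sqrt n)) ↔
        a = 1 / Real.sqrt n ∧ b = 1 / Real.sqrt n)) ∧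
    (upperFrameBound (sechGabor (1 / Real.sqrt n) (1 / Real.sqrt n)) ≤
        upperFrameBound (sechGabor a b) ∧
      (upperFrameBound (sechGabor (1 / Real.sqrt n) (1 / Real.sqrt n)) =
          upperFrameBound (sechGabor a b) ↔
        a = 1 / Real.sqrt n ∧ b = 1 / Real.sqrt n)) ∧
    (frameConditionNumber (sechGabor (1 / Real.sqrt n) (1 / Real.sqrt n)) ≤
        frameConditionNumber (sechGabor a b) ∧
      (frameConditionNumber (sechGabor (1 / Real.sqrt n) (1 / Real.sqrt n)) =
          frameConditionNumber (sechGabor a b) ↔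
        a = 1 / Real.sqrt n ∧ b = 1 / Real.sqrt n)) := by
  have hn' : n ≠ 0 := by omega
  have hn0 : (0 : ℝ) < n := by exact_mod_cast Nat.pos_of_ne_zero hn'
  have hν : 0 < Real.sqrt n := Real.sqrt_pos.2 hn0
  have hsq : Real.sqrt n * Real.sqrt n = n := Real.mul_self_sqrt hn0.le
  have hb' : b = (n * a)⁻¹ := by
    rw [← hab]
    field_simp
  have ha₀ : 0 < 1 / Real.sqrt n := by positivity
  have hb₀ : 1 / Real.sqrt n = (n * (1 / Real.sqrt n))⁻¹ := by
    refine eq_inv_of_mul_eq_one_left ?_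
    field_simp
    linarith
  have hL := lowerValue_pos hn ha
  have hL₀ := lowerValue_pos hn ha₀
  have hU := upperValue_pos hn' ha
  have hU₀ := upperValue_pos hn' ha₀
  have hframe : IsFrame (sechGabor a b) := by
    refine ⟨lowerValue n a, max (lowerValue n a) (upperValue n a), hL, le_max_left _ _,
      fun F => ⟨le_frameSum_sechGabor hn ha hb' F, (frameSum_sechGabor_le hn' ha hb' F).trans ?_⟩⟩
    gcongr
    exact le_max_right _ _
  refine ⟨hframe, ?_⟩
  simp only [frameConditionNumber]
  rw [lowerFrameBound_sechGabor hn ha hb', lowerFrameBound_sechGabor hn ha₀ hb₀,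
    upperFrameBound_sechGabor hn' ha hb', upperFrameBound_sechGabor hn' ha₀ hb₀,
    ← ENNReal.ofReal_div_of_pos hL, ← ENNReal.ofReal_div_of_pos hL₀]
  by_cases h : a = 1 / Real.sqrt n
  · have hbν : b = 1 / Real.sqrt n := by rw [hb', h, ← hb₀]
    rw [← h]
    simp [hbν, h]
  · have h1 := lowerValue_lt hn ha h
    have h2 := upperValue_lt hn' ha h
    have h3 : upperValue n (1 / Real.sqrt n) / lowerValue n (1 / Real.sqrt n)
        < upperValue n a / lowerValue n a := by gcongr
    have e1 := (ENNReal.ofReal_lt_ofReal_iff hL₀).2 h1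
    have e2 := (ENNReal.ofReal_lt_ofReal_iff hU).2 h2
    have e3 := (ENNReal.ofReal_lt_ofReal_iff (div_pos hU hL)).2 h3
    simp only [h, false_and, iff_false]
    exact ⟨⟨e1.le, e1.ne⟩, ⟨e2.le, e2.ne⟩, ⟨e3.le, e3.ne⟩⟩
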